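/- Let $M$ be a (Hausdorff) smooth manifold of dimension $m$. Let $\Omega(M)=\bigoplus_k\Omega^k(M)$ be the differential forms and $\Omega(M;TM)=\bigoplus_{k=0}^m\Omega^k(M;TM)$ the tangent bundle valued forms on $M$, and let $I=\mathrm{Id}_{TM}\in\Omega^1(M;TM)$. For $K\in\Omega^k(M;TM)$ let $i_K$ be the insertion operator, determined by $i_{\varphi\otimes X}\omega=\varphi\wedge i_X\omega$, and $\Theta(K)=[i_K,d]=i_K\circ d-(-1)^{k-1}d\circ i_K$ the Lie derivative on $\Omega(M)$. The Frölicher–Nijenhuis bracket of $K\in\Omega^k(M;TM)$ and $L\in\Omega^\ell(M;TM)$ is the unique $[K,L]\in\Omega^{k+\ell}(M;TM)$ with $\Theta([K,L])=\Theta(K)\Theta(L)-(-1)^{k\ell}\Theta(L)\Theta(K)$, extended bilinearly. Put $$\Omega^{*-1}(M)=\bigoplus_{k=0}^{m-1}\Omega^k(M),\qquad Z^{*-1}(M)=\bigoplus_{k=0}^{m-1}Z^k(M),\qquad B^{*-1}(M)=\bigoplus_{k=0}^{m-1}B^k(M),$$ where $Z^k(M)$ and $B^k(M)$ are the closed and the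 exact $k$-forms; thus the top degree $m$ is replaced by $0$. Then: 1. $B^{*-1}(M)\wedge I$ is an abelian (graded) ideal of $(\Omega(M;TM),[\ ,\ ])$. 2. $Z^{*-1}(M)\wedge I$ is an abelian (graded) ideal of $(\Omega(M;TM),[\ ,\ ])$. 3. $\Omega^{*-1}(M)\wedge I$ is a graded Lie subalgebra of $(\Omega(M;TM),[\ ,\ ])$. Moreover $\varphi\mapsto\varphi\wedge I$ is injective on $\Omega^{*-1}(M)$, so there is an induced bracket on $\Omega^{*-1}(M)$ with $[\varphi,\psi]\wedge I=[\varphi\wedge I,\psi\wedge I]$. With it $\Omega^{*-1}(M)$ is a graded Lie algebra, where $k$-forms have degree $k+1$, and for $\varphi\in\Omega^k(M)$, $\psi\in\Omega^\ell(M)$ with $k,\ell<m$ $$\begin{aligned}[\varphi,\psi]&=(-1)^{k-1}\,d\varphi\wedge \ell\psi-(-1)^{(k-1)(\ell-1)}(-1)^{\ell-1}\,d\psi\wedge k\varphi\\&=(-1)^{k-1}\,\Theta(I)\varphi\wedge i_I\psi-(-1)^{(k-1)(\ell-1)}(-1)^{\ell-1}\,\Theta(I)\psi\wedge i_I\varphi,\end{aligned}$$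 where the right hand sides are read as $0$ if $k+\ell+1\ge m$. -/

import Mathlib

open scoped Manifold ContDiff DirectSum

noncomputable section

set_option linter.unusedSectionVars false
set_option linter.unusedSimpArgs false

namespace FrolicherNijenhuis

section Update

variable {V : Type*}

theorem update_castAdd_left {k l : ℕ} [DecidableEq (Fin (k + l))] (v : Fin (k + l) → V) (i : Fin k) (x : V) :
    (fun j => Function.update v (Fin.castAdd l i) x (Fin.castAdd l j)) =
      Function.update (fun j => v (Fin.castAdd l j)) i x := by
  funext j
  by_cases h : j = i
  · subst h; simp
  · rw [Function.update_of_ne h, Function.update_of_ne]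
    simpa using h

theorem update_castAdd_right {k l : ℕ} [DecidableEq (Fin (k + l))] (v : Fin (k + l) → V) (i : Fin k) (x : V) :
    (fun j => Function.update v (Fin.castAdd l i) x (Fin.natAdd k j)) =
      fun j => v (Fin.natAdd k j) := by
  funext j
  rw [Function.update_of_ne]
  intro h
  have := congrArg Fin.val h
  simp at this
  omega

theorem update_natAdd_left {k l : ℕ} [DecidableEq (Fin (k + l))] (v : Fin (k + l) → V) (i : Fin l) (x : V) :
    (fun j => Function.update v (Fin.natAdd k i) x (Fin.castAdd l j)) =
      fun j => v (Fin.castAdd l j) := by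
  funext j
  rw [Function.update_of_ne]
  intro h
  have := congrArg Fin.val h
  simp at this
  omega

theorem update_natAdd_right {k l : ℕ} [DecidableEq (Fin (k + l))] (v : Fin (k + l) → V) (i : Fin l) (x : V) :
    (fun j => Function.update v (Fin.natAdd k i) x (Fin.natAdd k j)) =
      Function.update (fun j => v (Fin.natAdd k j)) i x := by
  funext j
  by_cases h : j = i
  · subst h; simp
  · rw [Function.update_of_ne h, Function.update_of_ne]
    simpa using h

end Update

section Fibre

variable {V F : Type*} [AddCommGroup V] [Module ℝ V] [TopologicalSpace V]
  [IsTopologicalAddGroup V] [ContinuousSMul ℝ V]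
  [AddCommGroup F] [Module ℝ F] [TopologicalSpace F] [IsTopologicalAddGroup F]
  [ContinuousSMul ℝ F]

/-- The multilinear map `(v₁, …, v_{k+l}) ↦ α(v₁, …, v_k) • β(v_{k+1}, …, v_{k+l})`. -/
def tensorAlt {k l : ℕ} (α : V [⋀^Fin k]→L[ℝ] ℝ) (β : V [⋀^Fin l]→L[ℝ] F) :
    ContinuousMultilinearMap ℝ (fun _ : Fin (k + l) => V) F where
  toFun v := α (fun i => v (Fin.castAdd l i)) • β (fun j => v (Fin.natAdd k j))
  map_update_add' := by
    intro _ v i x y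
    induction i using Fin.addCases with
    | left i =>
      simp only [update_castAdd_left, update_castAdd_right]
      simp [add_smul]
    | right i =>
      simp only [update_natAdd_left, update_natAdd_right]
      simp
  map_update_smul' := by
    intro _ v i c x
    induction i using Fin.addCases with
    | left i =>
      simp only [update_castAdd_left, update_castAdd_right]
      simp [mul_smul]
    | right i =>
      simp only [update_natAdd_left, update_natAdd_right]
      simp [smul_comm c]
  cont := by
    exact (α.cont.comp (by fun_prop)).smul (β.cont.comp (by fun_prop))

/-- The multilinear map `(v₁, …, v_{k+q}) ↦ α(K(v₁, …, v_k), v_{k+1}, …, v_{k+q})`. -/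
def substAlt {k q : ℕ} (K : V [⋀^Fin k]→L[ℝ] V) (α : V [⋀^Fin (q + 1)]→L[ℝ] F) :
    ContinuousMultilinearMap ℝ (fun _ : Fin (k + q) => V) F where
  toFun v := α (Fin.cons (K (fun i => v (Fin.castAdd q i))) (fun j => v (Fin.natAdd k j)))
  map_update_add' := by
    intro _ v i x y
    induction i using Fin.addCases with
    | left i =>
      simp only [update_castAdd_left, update_castAdd_right, K.map_update_add, α.cons_add]
    | right i =>
      simp only [update_natAdd_left, update_natAdd_right, Fin.cons_update]
      simp
  map_update_smul' := by
    intro _ v i c x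
    induction i using Fin.addCases with
    | left i =>
      simp only [update_castAdd_left, update_castAdd_right, K.map_update_smul, α.cons_smul]
    | right i =>
      simp only [update_natAdd_left, update_natAdd_right, Fin.cons_update]
      simp
  cont := by
    refine α.cont.comp (continuous_pi fun j => ?_)
    induction j using Fin.cases with
    | zero => exact K.cont.comp (by fun_prop)
    | succ j => simpa using continuous_apply _

theorem tensorAlt_apply {k l : ℕ} (α : V [⋀^Fin k]→L[ℝ] ℝ) (β : V [⋀^Fin l]→L[ℝ] F)
    (v : Fin (k + l) → V) : tensorAlt α β v =
      α (fun i => v (Fin.castAdd l i)) • β (fun j => v (Fin.natAdd k j)) := rfl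

theorem substAlt_apply {k q : ℕ} (K : V [⋀^Fin k]→L[ℝ] V) (α : V [⋀^Fin (q + 1)]→L[ℝ] F)
    (v : Fin (k + q) → V) : substAlt K α v =
      α (Fin.cons (K (fun i => v (Fin.castAdd q i))) (fun j => v (Fin.natAdd k j))) := rfl

/-- Wedge product of a scalar alternating form with an `F`-valued one,
`(α ∧ β)(v₁, …, v_{k+l}) = 1/(k! l!) ∑_σ sign σ • α(v_{σ1}, …, v_{σk}) • β(v_{σ(k+1)}, …)`. -/
def altWedge (k l : ℕ) : (V [⋀^Fin k]→L[ℝ] ℝ) →ₗ[ℝ] (V [⋀^Fin l]→L[ℝ] F) →ₗ[ℝ]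
    (V [⋀^Fin (k + l)]→L[ℝ] F) :=
  LinearMap.mk₂ ℝ
    (fun α β => ((k.factorial * l.factorial : ℝ)⁻¹) •
      ContinuousMultilinearMap.alternatization (tensorAlt α β))
    (by
      intro α α' β
      ext v
      simp only [ContinuousMultilinearMap.alternatization_apply_apply, tensorAlt_apply,
        ContinuousAlternatingMap.add_apply, ContinuousAlternatingMap.smul_apply,
        add_smul, smul_add, Finset.sum_add_distrib])
    (by
      intro c α β
      ext v
      simp only [ContinuousMultilinearMap.alternatization_apply_apply, tensorAlt_apply,
        ContinuousAlternatingMap.add_apply, ContinuousAlternatingMap.smul_apply,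
        smul_assoc, Finset.smul_sum, smul_comm _ c])
    (by
      intro α β β'
      ext v
      simp only [ContinuousMultilinearMap.alternatization_apply_apply, tensorAlt_apply,
        ContinuousAlternatingMap.add_apply, ContinuousAlternatingMap.smul_apply,
        smul_add, Finset.sum_add_distrib])
    (by
      intro c α β
      ext v
      simp only [ContinuousMultilinearMap.alternatization_apply_apply, tensorAlt_apply,
        ContinuousAlternatingMap.add_apply, ContinuousAlternatingMap.smul_apply,
        Finset.smul_sum, smul_comm _ c])

/-- Insertion of a vector valued form into a form,
`(i_K α)(v₁, …, v_{k+q}) = 1/(k! q!) ∑_σ sign σ • α(K(v_{σ1}, …, v_{σk}), v_{σ(k+1)}, …)`. -/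
def altInsert (k q : ℕ) : (V [⋀^Fin k]→L[ℝ] V) →ₗ[ℝ] (V [⋀^Fin (q + 1)]→L[ℝ] F) →ₗ[ℝ]
    (V [⋀^Fin (k + q)]→L[ℝ] F) :=
  LinearMap.mk₂ ℝ
    (fun K α => ((k.factorial * q.factorial : ℝ)⁻¹) •
      ContinuousMultilinearMap.alternatization (substAlt K α))
    (by
      intro K K' α
      ext v
      simp only [ContinuousMultilinearMap.alternatization_apply_apply, substAlt_apply,
        ContinuousAlternatingMap.add_apply, ContinuousAlternatingMap.smul_apply,
        α.cons_add, smul_add, Finset.sum_add_distrib])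
    (by
      intro c K α
      ext v
      simp only [ContinuousMultilinearMap.alternatization_apply_apply, substAlt_apply,
        ContinuousAlternatingMap.add_apply, ContinuousAlternatingMap.smul_apply,
        α.cons_smul, Finset.smul_sum, smul_comm _ c])
    (by
      intro K α α'
      ext v
      simp only [ContinuousMultilinearMap.alternatization_apply_apply, substAlt_apply,
        ContinuousAlternatingMap.add_apply, ContinuousAlternatingMap.smul_apply,
        smul_add, Finset.sum_add_distrib])
    (by
      intro c K α
      ext v
      simp only [ContinuousMultilinearMap.alternatization_apply_apply, substAlt_apply,
        ContinuousAlternatingMap.add_apply, ContinuousAlternatingMap.smul_apply,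
        Finset.smul_sum, smul_comm _ c])

theorem altWedge_apply {k l : ℕ} (α : V [⋀^Fin k]→L[ℝ] ℝ) (β : V [⋀^Fin l]→L[ℝ] F)
    (v : Fin (k + l) → V) :
    altWedge k l α β v = ((k.factorial * l.factorial : ℝ)⁻¹) •
      ∑ σ : Equiv.Perm (Fin (k + l)), Equiv.Perm.sign σ •
        (α (fun i => v (σ (Fin.castAdd l i))) • β (fun j => v (σ (Fin.natAdd k j)))) := by
  simp only [altWedge, LinearMap.mk₂_apply, ContinuousAlternatingMap.smul_apply,
    ContinuousMultilinearMap.alternatization_apply_apply, tensorAlt_apply, Function.comp_apply]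

theorem altInsert_apply {k q : ℕ} (K : V [⋀^Fin k]→L[ℝ] V) (α : V [⋀^Fin (q + 1)]→L[ℝ] F)
    (v : Fin (k + q) → V) :
    altInsert k q K α v = ((k.factorial * q.factorial : ℝ)⁻¹) •
      ∑ σ : Equiv.Perm (Fin (k + q)), Equiv.Perm.sign σ •
        α (Fin.cons (K (fun i => v (σ (Fin.castAdd q i)))) (fun j => v (σ (Fin.natAdd k j)))) := by
  simp only [altInsert, LinearMap.mk₂_apply, ContinuousAlternatingMap.smul_apply,
    ContinuousMultilinearMap.alternatization_apply_apply, substAlt_apply, Function.comp_apply]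

end Fibre

section Naturality

variable {V W F G : Type*} [AddCommGroup V] [Module ℝ V] [TopologicalSpace V]
  [IsTopologicalAddGroup V] [ContinuousSMul ℝ V]
  [AddCommGroup W] [Module ℝ W] [TopologicalSpace W]
  [IsTopologicalAddGroup W] [ContinuousSMul ℝ W]
  [AddCommGroup F] [Module ℝ F] [TopologicalSpace F] [IsTopologicalAddGroup F]
  [ContinuousSMul ℝ F]
  [AddCommGroup G] [Module ℝ G] [TopologicalSpace G] [IsTopologicalAddGroup G]
  [ContinuousSMul ℝ G]

theorem altWedge_comp {k l : ℕ} (α : V [⋀^Fin k]→L[ℝ] ℝ) (β : V [⋀^Fin l]→L[ℝ] F)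
    (g : W →L[ℝ] V) (h : F →L[ℝ] G) :
    h.compContinuousAlternatingMap ((altWedge k l α β).compContinuousLinearMap g) =
      altWedge k l (α.compContinuousLinearMap g)
        (h.compContinuousAlternatingMap (β.compContinuousLinearMap g)) := by
  ext v
  simp [altWedge_apply, Function.comp_def, map_sum, Units.smul_def]

theorem altWedge_comp_right {k l : ℕ} (α : V [⋀^Fin k]→L[ℝ] ℝ) (β : V [⋀^Fin l]→L[ℝ] F)
    (g : W →L[ℝ] V) :
    (altWedge k l α β).compContinuousLinearMap g =
      altWedge k l (α.compContinuousLinearMap g) (β.compContinuousLinearMap g) := by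
  ext v
  simp [altWedge_apply, Function.comp_def]

theorem altInsert_comp {k q : ℕ} (K : V [⋀^Fin k]→L[ℝ] V) (α : V [⋀^Fin (q + 1)]→L[ℝ] F)
    (g : W →L[ℝ] V) (h : V →L[ℝ] W) (hgh : ∀ v, g (h v) = v) :
    (altInsert k q K α).compContinuousLinearMap g =
      altInsert k q (h.compContinuousAlternatingMap (K.compContinuousLinearMap g))
        (α.compContinuousLinearMap g) := by
  ext v
  simp only [altInsert_apply, ContinuousAlternatingMap.compContinuousLinearMap_apply, Function.comp_def]
  congr 1
  refine Finset.sum_congr rfl fun σ _ => ?_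
  congr 2
  funext j
  induction j using Fin.cases with
  | zero => simp [hgh, Function.comp_def]
  | succ j => simp

end Naturality

section Smoothness

variable {E F : Type*} [NormedAddCommGroup E] [NormedSpace ℝ E] [FiniteDimensional ℝ E]
  [NormedAddCommGroup F] [NormedSpace ℝ F] [FiniteDimensional ℝ F]

theorem finiteDimensional_alt (k : ℕ) : FiniteDimensional ℝ (E [⋀^Fin k]→L[ℝ] F) := by
  let f : (E [⋀^Fin k]→L[ℝ] F) →ₗ[ℝ] MultilinearMap ℝ (fun _ : Fin k => E) F :=
    { toFun := fun α => α.toAlternatingMap.toMultilinearMap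
      map_add' := fun _ _ => rfl
      map_smul' := fun _ _ => rfl }
  refine FiniteDimensional.of_injective f fun α β h => ?_
  ext v
  exact congrArg (fun g : MultilinearMap ℝ (fun _ : Fin k => E) F => g v) h

theorem contDiffOn_bilinear {X A B C : Type*} [NormedAddCommGroup X] [NormedSpace ℝ X]
    [NormedAddCommGroup A] [NormedSpace ℝ A] [FiniteDimensional ℝ A]
    [NormedAddCommGroup B] [NormedSpace ℝ B] [FiniteDimensional ℝ B]
    [NormedAddCommGroup C] [NormedSpace ℝ C] (b : A →ₗ[ℝ] B →ₗ[ℝ] C)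
    {f : X → A} {g : X → B} {s : Set X} (hf : ContDiffOn ℝ ∞ f s) (hg : ContDiffOn ℝ ∞ g s) :
    ContDiffOn ℝ ∞ (fun x => b (f x) (g x)) s :=
  (b.toContinuousBilinearMap.contDiff.comp_contDiffOn hf).clm_apply hg

end Smoothness

section Manifold

/-- The model space `ℝᵐ`. -/
abbrev Euc (m : ℕ) : Type := EuclideanSpace ℝ (Fin m)

variable (m : ℕ) (M : Type*) [TopologicalSpace M] [ChartedSpace (EuclideanSpace ℝ (Fin m)) M]

/-- Not necessarily smooth scalar differential forms of degree `k`. -/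
abbrev RawForm (k : ℕ) : Type _ := ∀ x : M, TangentSpace (𝓡 m) x [⋀^Fin k]→L[ℝ] ℝ

/-- Not necessarily smooth tangent bundle valued differential forms of degree `k`. -/
abbrev RawVForm (k : ℕ) : Type _ :=
  ∀ x : M, TangentSpace (𝓡 m) x [⋀^Fin k]→L[ℝ] TangentSpace (𝓡 m) x

variable {m M}

/-- The derivative at `y : ℝᵐ` of the inverse of the preferred chart at `x₀`. -/
abbrev chartSymmD (x₀ : M) (y : Euc m) :
    Euc m →L[ℝ] TangentSpace (𝓡 m) ((extChartAt (𝓡 m) x₀).symm y) :=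
  mfderiv 𝓘(ℝ, Euc m) (𝓡 m) (extChartAt (𝓡 m) x₀).symm y

/-- The derivative at `x` of the preferred chart at `x₀`. -/
abbrev chartD (x₀ x : M) : TangentSpace (𝓡 m) x →L[ℝ] Euc m :=
  mfderiv (𝓡 m) 𝓘(ℝ, Euc m) (extChartAt (𝓡 m) x₀) x

/-- A scalar form read in the preferred chart at `x₀`: its pullback along the inverse chart. -/
def chartRep {k : ℕ} (α : RawForm m M k) (x₀ : M) (y : Euc m) : Euc m [⋀^Fin k]→L[ℝ] ℝ :=
  (α ((extChartAt (𝓡 m) x₀).symm y)).compContinuousLinearMap (chartSymmD x₀ y)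

/-- A tangent bundle valued form read in the preferred chart at `x₀`. -/
def chartRepV {k : ℕ} (K : RawVForm m M k) (x₀ : M) (y : Euc m) :
    Euc m [⋀^Fin k]→L[ℝ] Euc m :=
  (chartD x₀ ((extChartAt (𝓡 m) x₀).symm y)).compContinuousAlternatingMap
    ((K ((extChartAt (𝓡 m) x₀).symm y)).compContinuousLinearMap (chartSymmD x₀ y))

theorem chartRep_add {k : ℕ} (α β : RawForm m M k) (x₀ : M) :
    chartRep (α + β) x₀ = chartRep α x₀ + chartRep β x₀ := rfl

theorem chartRep_smul {k : ℕ} (c : ℝ) (α : RawForm m M k) (x₀ : M) :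
    chartRep (c • α) x₀ = c • chartRep α x₀ := rfl

theorem chartRepV_add {k : ℕ} (K L : RawVForm m M k) (x₀ : M) :
    chartRepV (K + L) x₀ = chartRepV K x₀ + chartRepV L x₀ := by
  funext y; ext1 v
  exact map_add (chartD x₀ _) _ _

theorem chartRepV_smul {k : ℕ} (c : ℝ) (K : RawVForm m M k) (x₀ : M) :
    chartRepV (c • K) x₀ = c • chartRepV K x₀ := by
  funext y; ext1 v
  exact map_smul (chartD x₀ _) c _

theorem chartRepV_zero {k : ℕ} (x₀ : M) :
    chartRepV (0 : RawVForm m M k) x₀ = fun _ => 0 := by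
  funext y; ext1 v
  exact map_zero (chartD x₀ _)

variable (m M)

/-- The smooth ones among the differential forms of degree `k`. -/
def smoothForms (k : ℕ) : Submodule ℝ (RawForm m M k) where
  carrier := {α | ∀ x₀ : M, ContDiffOn ℝ ∞ (chartRep α x₀) (extChartAt (𝓡 m) x₀).target}
  add_mem' := by
    intro α β hα hβ x₀
    exact (hα x₀).add (hβ x₀)
  zero_mem' := by
    intro x₀
    exact contDiffOn_const (c := (0 : Euc m [⋀^Fin k]→L[ℝ] ℝ))
  smul_mem' := by
    intro c α hα x₀
    exact (hα x₀).const_smul c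

/-- The smooth ones among the tangent bundle valued differential forms of degree `k`. -/
def smoothVForms (k : ℕ) : Submodule ℝ (RawVForm m M k) where
  carrier := {K | ∀ x₀ : M, ContDiffOn ℝ ∞ (chartRepV K x₀) (extChartAt (𝓡 m) x₀).target}
  add_mem' := by
    intro K L hK hL x₀
    rw [chartRepV_add]
    exact (hK x₀).add (hL x₀)
  zero_mem' := by
    intro x₀
    rw [chartRepV_zero]
    exact contDiffOn_const
  smul_mem' := by
    intro c K hK x₀
    rw [chartRepV_smul]
    exact (hK x₀).const_smul c

variable {m M}

/-- Exterior derivative of a form at `x`, computed in the preferred chart at `x`. -/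
def rawExtD {k : ℕ} (α : RawForm m M k) : RawForm m M (k + 1) := fun x =>
  (extDeriv (chartRep α x) (extChartAt (𝓡 m) x x)).compContinuousLinearMap (chartD x x)

/-- Pointwise wedge product of scalar forms. -/
def rawWedge {k l : ℕ} (α : RawForm m M k) (β : RawForm m M l) : RawForm m M (k + l) :=
  fun x => altWedge k l (α x) (β x)

/-- Pointwise wedge product of a scalar form and a tangent bundle valued form. -/
def rawWedgeV {k l : ℕ} (α : RawForm m M k) (K : RawVForm m M l) : RawVForm m M (k + l) :=
  fun x => altWedge k l (α x) (K x)

/-- Pointwise insertion `i_K α`. -/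
def rawInsert {k q : ℕ} (K : RawVForm m M k) (α : RawForm m M (q + 1)) : RawForm m M (k + q) :=
  fun x => altInsert k q (K x) (α x)

/-- `Id_{TM}`, as a tangent bundle valued `1`-form. -/
def rawId : RawVForm m M 1 := fun x =>
  ContinuousAlternatingMap.ofSubsingleton ℝ (TangentSpace (𝓡 m) x) (TangentSpace (𝓡 m) x) (0 : Fin 1)
    (ContinuousLinearMap.id ℝ (TangentSpace (𝓡 m) x))

section Charts

variable [IsManifold (𝓡 m) ∞ M]

theorem isOpen_target (x₀ : M) : IsOpen (extChartAt (𝓡 m) x₀).target :=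
  isOpen_extChartAt_target x₀

theorem chartD_chartSymmD (x₀ : M) {y : Euc m} (hy : y ∈ (extChartAt (𝓡 m) x₀).target) (v : Euc m) :
    chartD x₀ ((extChartAt (𝓡 m) x₀).symm y) (chartSymmD x₀ y v) = v := by
  have : IsManifold (𝓡 m) 1 M := .of_le (n := ∞) (by simp)
  have h := mfderiv_extChartAt_comp_mfderivWithin_extChartAt_symm (I := 𝓡 m) hy
  rw [ModelWithCorners.range_eq_univ, mfderivWithin_univ] at h
  exact congrArg (fun g => g v) h

theorem chartSymmD_chartD (x₀ : M) {y : Euc m} (hy : y ∈ (extChartAt (𝓡 m) x₀).target)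
    (v : TangentSpace (𝓡 m) ((extChartAt (𝓡 m) x₀).symm y)) :
    chartSymmD x₀ y (chartD x₀ ((extChartAt (𝓡 m) x₀).symm y) v) = v := by
  have : IsManifold (𝓡 m) 1 M := .of_le (n := ∞) (by simp)
  have h := mfderivWithin_extChartAt_symm_comp_mfderiv_extChartAt (I := 𝓡 m) hy
  rw [ModelWithCorners.range_eq_univ, mfderivWithin_univ] at h
  exact congrArg (fun g => g v) h

theorem chartRep_comp_chartD {k : ℕ} (α : RawForm m M k) (x₁ p : M)
    (hp : p ∈ (extChartAt (𝓡 m) x₁).source) :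
    (chartRep α x₁ (extChartAt (𝓡 m) x₁ p)).compContinuousLinearMap (chartD x₁ p) = α p := by
  obtain ⟨y, hy, rfl⟩ : ∃ y ∈ (extChartAt (𝓡 m) x₁).target, (extChartAt (𝓡 m) x₁).symm y = p :=
    ⟨_, (extChartAt (𝓡 m) x₁).map_source hp, (extChartAt (𝓡 m) x₁).left_inv hp⟩
  rw [(extChartAt (𝓡 m) x₁).right_inv hy]
  ext v
  simp only [chartRep, ContinuousAlternatingMap.compContinuousLinearMap_apply, Function.comp_def]
  congr 1
  funext i
  exact chartSymmD_chartD x₁ hy (v i)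

theorem contDiffAt_transition (x₀ x₁ : M) {y : Euc m} (hy : y ∈ (extChartAt (𝓡 m) x₀).target)
    (hy' : (extChartAt (𝓡 m) x₀).symm y ∈ (extChartAt (𝓡 m) x₁).source) :
    ContDiffAt ℝ ∞ (fun z => extChartAt (𝓡 m) x₁ ((extChartAt (𝓡 m) x₀).symm z)) y := by
  have h1 : ContMDiffAt (𝓡 m) 𝓘(ℝ, Euc m) ∞ (extChartAt (𝓡 m) x₁)
      ((extChartAt (𝓡 m) x₀).symm y) := contMDiffAt_extChartAt' (by simpa using hy')
  have h2 : ContMDiffAt 𝓘(ℝ, Euc m) (𝓡 m) ∞ (extChartAt (𝓡 m) x₀).symm y :=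
    (contMDiffOn_extChartAt_symm x₀).contMDiffAt ((isOpen_target x₀).mem_nhds hy)
  exact (h1.comp y h2).contDiffAt

theorem fderiv_transition (x₀ x₁ : M) {y : Euc m} (hy : y ∈ (extChartAt (𝓡 m) x₀).target)
    (hy' : (extChartAt (𝓡 m) x₀).symm y ∈ (extChartAt (𝓡 m) x₁).source) :
    fderiv ℝ (fun z => extChartAt (𝓡 m) x₁ ((extChartAt (𝓡 m) x₀).symm z)) y =
      (chartD x₁ ((extChartAt (𝓡 m) x₀).symm y)).comp (chartSymmD x₀ y) := by
  have h1 : ContMDiffAt (𝓡 m) 𝓘(ℝ, Euc m) ∞ (extChartAt (𝓡 m) x₁)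
      ((extChartAt (𝓡 m) x₀).symm y) := contMDiffAt_extChartAt' (by simpa using hy')
  have h2 : ContMDiffAt 𝓘(ℝ, Euc m) (𝓡 m) ∞ (extChartAt (𝓡 m) x₀).symm y :=
    (contMDiffOn_extChartAt_symm x₀).contMDiffAt ((isOpen_target x₀).mem_nhds hy)
  rw [← mfderiv_eq_fderiv]
  exact mfderiv_comp y (h1.mdifferentiableAt (by simp)) (h2.mdifferentiableAt (by simp))

theorem chartRep_change {k : ℕ} (α : RawForm m M k) (x₀ x₁ : M) {y : Euc m}
    (hy : y ∈ (extChartAt (𝓡 m) x₀).target)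
    (hy' : (extChartAt (𝓡 m) x₀).symm y ∈ (extChartAt (𝓡 m) x₁).source) :
    chartRep α x₀ y =
      (chartRep α x₁ (extChartAt (𝓡 m) x₁ ((extChartAt (𝓡 m) x₀).symm y))).compContinuousLinearMap
        (fderiv ℝ (fun z => extChartAt (𝓡 m) x₁ ((extChartAt (𝓡 m) x₀).symm z)) y) := by
  rw [fderiv_transition x₀ x₁ hy hy']
  have h := chartRep_comp_chartD α x₁ _ hy'
  ext v
  exact (congrArg (fun a => a (fun i => chartSymmD x₀ y (v i))) h).symm

theorem chartRep_rawExtD {k : ℕ} {α : RawForm m M k} (hα : α ∈ smoothForms m M k) (x₀ : M) {y : Euc m}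
    (hy : y ∈ (extChartAt (𝓡 m) x₀).target) :
    chartRep (rawExtD α) x₀ y = extDeriv (chartRep α x₀) y := by
  set p := (extChartAt (𝓡 m) x₀).symm y with hp
  have hsrc : p ∈ (extChartAt (𝓡 m) p).source := mem_extChartAt_source p
  have hev : chartRep α x₀ =ᶠ[nhds y] fun z =>
      (chartRep α p (extChartAt (𝓡 m) p ((extChartAt (𝓡 m) x₀).symm z))).compContinuousLinearMap
        (fderiv ℝ (fun z => extChartAt (𝓡 m) p ((extChartAt (𝓡 m) x₀).symm z)) z) := by
    have hc : ContinuousAt (extChartAt (𝓡 m) x₀).symm y :=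
      (continuousOn_extChartAt_symm x₀).continuousAt ((isOpen_target x₀).mem_nhds hy)
    filter_upwards [(isOpen_target x₀).mem_nhds hy,
      hc.preimage_mem_nhds ((isOpen_extChartAt_source p).mem_nhds hsrc)] with z hz hz'
    exact chartRep_change α x₀ p hz hz'
  have htgt : extChartAt (𝓡 m) p p ∈ (extChartAt (𝓡 m) p).target := mem_extChartAt_target p
  have hd : DifferentiableAt ℝ (chartRep α p) (extChartAt (𝓡 m) p p) :=
    ((hα p).contDiffAt ((isOpen_target p).mem_nhds htgt)).differentiableAt (by simp)
  rw [hev.extDeriv_eq, extDeriv_pullback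
    (f := fun z => extChartAt (𝓡 m) p ((extChartAt (𝓡 m) x₀).symm z)) hd
    (contDiffAt_transition x₀ p hy hsrc) (by simp only [minSmoothness_of_isRCLikeNormedField]; exact WithTop.coe_le_coe.2 le_top), fderiv_transition x₀ p hy hsrc]
  rfl

theorem rawExtD_mem {k : ℕ} {α : RawForm m M k} (hα : α ∈ smoothForms m M k) :
    rawExtD α ∈ smoothForms m M (k + 1) := by
  intro x₀
  have h : ContDiffOn ℝ ∞ (extDeriv (chartRep α x₀)) (extChartAt (𝓡 m) x₀).target :=
    (ContinuousAlternatingMap.alternatizeUncurryFinCLM ℝ (Euc m) ℝ).contDiff.comp_contDiffOn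
      ((hα x₀).fderiv_of_isOpen (isOpen_target x₀) (by simp))
  exact h.congr fun y hy => chartRep_rawExtD hα x₀ hy

theorem chartRep_rawWedge {k l : ℕ} (α : RawForm m M k) (β : RawForm m M l) (x₀ : M) (y : Euc m) :
    chartRep (rawWedge α β) x₀ y = altWedge k l (chartRep α x₀ y) (chartRep β x₀ y) :=
  altWedge_comp_right _ _ _

theorem chartRepV_rawWedgeV {k l : ℕ} (α : RawForm m M k) (K : RawVForm m M l) (x₀ : M)
    (y : Euc m) :
    chartRepV (rawWedgeV α K) x₀ y = altWedge k l (chartRep α x₀ y) (chartRepV K x₀ y) :=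
  altWedge_comp _ _ _ _

theorem chartRep_rawInsert {k q : ℕ} (K : RawVForm m M k) (α : RawForm m M (q + 1)) (x₀ : M)
    {y : Euc m} (hy : y ∈ (extChartAt (𝓡 m) x₀).target) :
    chartRep (rawInsert K α) x₀ y = altInsert k q (chartRepV K x₀ y) (chartRep α x₀ y) :=
  altInsert_comp _ _ _ _ (chartSymmD_chartD x₀ hy)

theorem chartRepV_rawId (x₀ : M) {y : Euc m} (hy : y ∈ (extChartAt (𝓡 m) x₀).target) :
    chartRepV (rawId : RawVForm m M 1) x₀ y =
      ContinuousAlternatingMap.ofSubsingleton ℝ (Euc m) (Euc m) (0 : Fin 1)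
        (ContinuousLinearMap.id ℝ (Euc m)) := by
  ext1 v
  exact chartD_chartSymmD x₀ hy (v 0)

theorem rawWedge_mem {k l : ℕ} {α : RawForm m M k} {β : RawForm m M l} (hα : α ∈ smoothForms m M k)
    (hβ : β ∈ smoothForms m M l) : rawWedge α β ∈ smoothForms m M (k + l) := by
  intro x₀
  have := finiteDimensional_alt (E := Euc m) (F := ℝ) k
  have := finiteDimensional_alt (E := Euc m) (F := ℝ) l
  exact (contDiffOn_bilinear (altWedge k l) (hα x₀) (hβ x₀)).congr
    fun y _ => chartRep_rawWedge α β x₀ y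

theorem rawWedgeV_mem {k l : ℕ} {α : RawForm m M k} {K : RawVForm m M l} (hα : α ∈ smoothForms m M k)
    (hK : K ∈ smoothVForms m M l) : rawWedgeV α K ∈ smoothVForms m M (k + l) := by
  intro x₀
  have := finiteDimensional_alt (E := Euc m) (F := ℝ) k
  have := finiteDimensional_alt (E := Euc m) (F := Euc m) l
  exact (contDiffOn_bilinear (altWedge k l) (hα x₀) (hK x₀)).congr
    fun y _ => chartRepV_rawWedgeV α K x₀ y

theorem rawInsert_mem {k q : ℕ} {K : RawVForm m M k} {α : RawForm m M (q + 1)}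
    (hK : K ∈ smoothVForms m M k) (hα : α ∈ smoothForms m M (q + 1)) :
    rawInsert K α ∈ smoothForms m M (k + q) := by
  intro x₀
  have := finiteDimensional_alt (E := Euc m) (F := Euc m) k
  have := finiteDimensional_alt (E := Euc m) (F := ℝ) (q + 1)
  exact (contDiffOn_bilinear (altInsert k q) (hK x₀) (hα x₀)).congr
    fun y hy => chartRep_rawInsert K α x₀ hy

theorem rawId_mem : (rawId : RawVForm m M 1) ∈ smoothVForms m M 1 := by
  intro x₀
  exact contDiffOn_const.congr fun y hy => chartRepV_rawId x₀ hy

end Charts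

variable (m M) in
/-- `Ω^k(M)`: smooth differential forms of degree `k`. -/
def Form (k : ℕ) : Type _ := smoothForms m M k

variable (m M) in
/-- `Ω^k(M; TM)`: smooth tangent bundle valued differential forms of degree `k`. -/
def VForm (k : ℕ) : Type _ := smoothVForms m M k

instance (k : ℕ) : AddCommGroup (Form m M k) := inferInstanceAs (AddCommGroup (smoothForms m M k))
instance (k : ℕ) : Module ℝ (Form m M k) := inferInstanceAs (Module ℝ (smoothForms m M k))
instance (k : ℕ) : AddCommGroup (VForm m M k) :=
  inferInstanceAs (AddCommGroup (smoothVForms m M k))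
instance (k : ℕ) : Module ℝ (VForm m M k) := inferInstanceAs (Module ℝ (smoothVForms m M k))

section Operators

variable [IsManifold (𝓡 m) ∞ M]

/-- The exterior derivative `d : Ω^k(M) → Ω^{k+1}(M)`. -/
def extD (k : ℕ) : Form m M k →ₗ[ℝ] Form m M (k + 1) where
  toFun α := ⟨rawExtD α.1, rawExtD_mem α.2⟩
  map_add' α β := by
    apply Subtype.ext
    funext x
    have hd : ∀ γ : Form m M k, DifferentiableAt ℝ (chartRep γ.1 x) (extChartAt (𝓡 m) x x) :=
      fun γ => ((γ.2 x).contDiffAt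
        ((isOpen_target x).mem_nhds (mem_extChartAt_target x))).differentiableAt (by simp)
    change (extDeriv (chartRep (α.1 + β.1) x) _).compContinuousLinearMap _ = _
    rw [chartRep_add, extDeriv_add (hd α) (hd β)]
    rfl
  map_smul' c α := by
    apply Subtype.ext
    funext x
    change (extDeriv (chartRep (c • α.1) x) _).compContinuousLinearMap _ = _
    rw [chartRep_smul, extDeriv_smul]
    rfl

/-- The wedge product `Ω^k(M) × Ω^l(M) → Ω^{k+l}(M)`. -/
def wedge (k l : ℕ) : Form m M k →ₗ[ℝ] Form m M l →ₗ[ℝ] Form m M (k + l) :=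
  LinearMap.mk₂ ℝ (fun α β => ⟨rawWedge α.1 β.1, rawWedge_mem α.2 β.2⟩)
    (fun _ _ _ => Subtype.ext (funext fun _ => LinearMap.map_add₂ _ _ _ _))
    (fun _ _ _ => Subtype.ext (funext fun _ => LinearMap.map_smul₂ _ _ _ _))
    (fun _ _ _ => Subtype.ext (funext fun _ => map_add _ _ _))
    (fun _ _ _ => Subtype.ext (funext fun _ => (altWedge k l _).map_smul _ _))

/-- The wedge product `Ω^k(M) × Ω^l(M; TM) → Ω^{k+l}(M; TM)`. -/
def wedgeV (k l : ℕ) : Form m M k →ₗ[ℝ] VForm m M l →ₗ[ℝ] VForm m M (k + l) :=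
  LinearMap.mk₂ ℝ (fun α K => ⟨rawWedgeV α.1 K.1, rawWedgeV_mem α.2 K.2⟩)
    (fun _ _ _ => Subtype.ext (funext fun _ => LinearMap.map_add₂ _ _ _ _))
    (fun _ _ _ => Subtype.ext (funext fun _ => LinearMap.map_smul₂ _ _ _ _))
    (fun _ _ _ => Subtype.ext (funext fun _ => map_add _ _ _))
    (fun _ _ _ => Subtype.ext (funext fun _ => (altWedge k l _).map_smul _ _))

/-- The insertion `(K, ω) ↦ i_K ω`, `Ω^k(M; TM) × Ω^{q+1}(M) → Ω^{k+q}(M)`. -/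
def insertion (k q : ℕ) : VForm m M k →ₗ[ℝ] Form m M (q + 1) →ₗ[ℝ] Form m M (k + q) :=
  LinearMap.mk₂ ℝ (fun K α => ⟨rawInsert K.1 α.1, rawInsert_mem K.2 α.2⟩)
    (fun _ _ _ => Subtype.ext (funext fun _ => LinearMap.map_add₂ _ _ _ _))
    (fun _ _ _ => Subtype.ext (funext fun _ => LinearMap.map_smul₂ _ _ _ _))
    (fun _ _ _ => Subtype.ext (funext fun _ => map_add _ _ _))
    (fun _ _ _ => Subtype.ext (funext fun _ => (altInsert k q _).map_smul _ _))

variable (m M) in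
/-- `I = Id_{TM} ∈ Ω¹(M; TM)`. -/
def idForm : VForm m M 1 := ⟨rawId, rawId_mem⟩

variable (m M)

/-- `Ω(M) = ⨁_k Ω^k(M)`. -/
abbrev Forms : Type _ := ⨁ k : ℕ, Form m M k

/-- `Ω(M; TM) = ⨁_k Ω^k(M; TM)`; the summands with `k > m` vanish. -/
abbrev VForms : Type _ := ⨁ k : ℕ, VForm m M k

variable {m M}

/-- A homogeneous form as an element of `Ω(M)`. -/
abbrev Form.toForms {k : ℕ} (α : Form m M k) : Forms m M :=
  DirectSum.lof ℝ ℕ (fun k => Form m M k) k α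

/-- A homogeneous tangent bundle valued form as an element of `Ω(M; TM)`. -/
abbrev VForm.toVForms {k : ℕ} (K : VForm m M k) : VForms m M :=
  DirectSum.lof ℝ ℕ (fun k => VForm m M k) k K

variable (m M) in
/-- The exterior derivative on `Ω(M)`. -/
def dTot : Forms m M →ₗ[ℝ] Forms m M :=
  DirectSum.toModule ℝ ℕ _ fun k =>
    (DirectSum.lof ℝ ℕ (fun k => Form m M k) (k + 1)).comp (extD k)

/-- The insertion `i_K` on `Ω(M)`; it vanishes on `Ω⁰(M)`. -/
def insTot {k : ℕ} (K : VForm m M k) : Forms m M →ₗ[ℝ] Forms m M :=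
  DirectSum.toModule ℝ ℕ _ fun q =>
    match q with
    | 0 => 0
    | q + 1 => (DirectSum.lof ℝ ℕ (fun k => Form m M k) (k + q)).comp (insertion k q K)

/-- The Lie derivative `Θ(K) = [i_K, d] = i_K ∘ d - (-1)^{k-1} d ∘ i_K` on `Ω(M)`, for
`K ∈ Ω^k(M; TM)`. -/
def lieD {k : ℕ} (K : VForm m M k) : Forms m M →ₗ[ℝ] Forms m M :=
  (insTot K).comp (dTot m M) + ((-1 : ℝ) ^ k) • (dTot m M).comp (insTot K)

/-- `N` is the Frölicher–Nijenhuis bracket of `K` and `L`: `Θ(N) = [Θ(K), Θ(L)]`, the graded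
commutator in `End Ω(M)`. -/
def IsFNBracket {k l : ℕ} (K : VForm m M k) (L : VForm m M l) (N : VForm m M (k + l)) : Prop :=
  lieD N = (lieD K).comp (lieD L) - ((-1 : ℝ) ^ (k * l)) • (lieD L).comp (lieD K)

/-- The Frölicher–Nijenhuis bracket `[K, L]` of homogeneous elements, the (unique) element with
`Θ([K, L]) = [Θ(K), Θ(L)]`. -/
def fnBracket {k l : ℕ} (K : VForm m M k) (L : VForm m M l) : VForm m M (k + l) :=
  Classical.epsilon (IsFNBracket K L)

/-- The Frölicher–Nijenhuis bracket on `Ω(M; TM) = ⨁_{k=0}^m Ω^k(M; TM)`. -/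
def fnTot (K L : VForms m M) : VForms m M :=
  ∑ k ∈ Finset.range (m + 1), ∑ l ∈ Finset.range (m + 1), (fnBracket (K k) (L l)).toVForms

variable (m M) in
/-- The wedge product on `Ω(M)`. -/
def wedgeTot : Forms m M →ₗ[ℝ] Forms m M →ₗ[ℝ] Forms m M :=
  DirectSum.toModule ℝ ℕ _ fun k => LinearMap.flip <| DirectSum.toModule ℝ ℕ _ fun l =>
    ((wedge k l).compr₂ (DirectSum.lof ℝ ℕ (fun k => Form m M k) (k + l))).flip

variable (m M) in
/-- `α ↦ α ∧ I`, from `Ω(M)` to `Ω(M; TM)`. -/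
def wedgeI : Forms m M →ₗ[ℝ] VForms m M :=
  DirectSum.toModule ℝ ℕ _ fun k =>
    (DirectSum.lof ℝ ℕ (fun k => VForm m M k) (k + 1)).comp ((wedgeV k 1).flip (idForm m M))

variable (m M) in
/-- `Ω^{*-1}(M) = ⨁_{k=0}^{m-1} Ω^k(M)`: forms without their top degree part. -/
abbrev LowForms : Type _ := ⨁ k : Fin m, Form m M (k : ℕ)

/-- A homogeneous form of degree `k < m` as an element of `Ω^{*-1}(M)`. -/
abbrev Form.toLow {k : Fin m} (α : Form m M (k : ℕ)) : LowForms m M :=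
  DirectSum.lof ℝ (Fin m) (fun k => Form m M (k : ℕ)) k α

variable (m M) in
/-- The inclusion of `Ω^{*-1}(M)` into `Ω(M)`. -/
def lowIncl : LowForms m M →ₗ[ℝ] Forms m M :=
  DirectSum.toModule ℝ (Fin m) _ fun k => DirectSum.lof ℝ ℕ (fun k => Form m M k) (k : ℕ)

variable (m M) in
/-- The projection of `Ω(M)` onto `Ω^{*-1}(M)`, which drops the components of degree `≥ m`. -/
def dropTop : Forms m M →ₗ[ℝ] LowForms m M :=
  DirectSum.toModule ℝ ℕ _ fun k =>
    if h : k < m then DirectSum.lof ℝ (Fin m) (fun k => Form m M (k : ℕ)) ⟨k, h⟩ else 0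

variable (m M) in
/-- `Z^{*-1}(M)`: the closed forms in `Ω^{*-1}(M)`. -/
def closedLow : Submodule ℝ (LowForms m M) := LinearMap.ker ((dTot m M).comp (lowIncl m M))

variable (m M) in
/-- `B^{*-1}(M)`: the exact forms in `Ω^{*-1}(M)`. -/
def exactLow : Submodule ℝ (LowForms m M) := (LinearMap.range (dTot m M)).comap (lowIncl m M)

variable (m M) in
/-- `α ↦ α ∧ I` on `Ω^{*-1}(M)`. -/
def lowWedgeI : LowForms m M →ₗ[ℝ] VForms m M := (wedgeI m M).comp (lowIncl m M)

variable (m M) in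
/-- The grading of `Ω^{*-1}(M)` for which `α ↦ α ∧ I` preserves degrees: `k`-forms have
degree `k + 1`. -/
def lowGrading (n : ℕ) : Submodule ℝ (LowForms m M) where
  carrier := {u | ∀ k : Fin m, (k : ℕ) + 1 ≠ n → u k = 0}
  add_mem' := by
    intro u v hu hv k hk
    rw [DirectSum.add_apply, hu k hk, hv k hk, add_zero]
  zero_mem' := fun _ _ => rfl
  smul_mem' := by
    intro c u hu k hk
    rw [DirectSum.smul_apply, hu k hk, smul_zero]

/-- A subspace of `Ω(M; TM)` that contains the homogeneous components of its elements. -/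
def IsGradedSubspace (W : Submodule ℝ (VForms m M)) : Prop :=
  ∀ K ∈ W, ∀ n : ℕ, (K n).toVForms ∈ W

/-- Graded Lie subalgebras of `Ω(M; TM)` with the Frölicher–Nijenhuis bracket. -/
def IsGradedLieSubalgebra (W : Submodule ℝ (VForms m M)) : Prop :=
  IsGradedSubspace W ∧ ∀ K ∈ W, ∀ L ∈ W, fnTot K L ∈ W

/-- Abelian (graded, two-sided) ideals of `Ω(M; TM)` with the Frölicher–Nijenhuis bracket. -/
def IsAbelianIdeal (W : Submodule ℝ (VForms m M)) : Prop :=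
  IsGradedSubspace W ∧ (∀ K : VForms m M, ∀ L ∈ W, fnTot K L ∈ W ∧ fnTot L K ∈ W) ∧
    ∀ K ∈ W, ∀ L ∈ W, fnTot K L = 0

end Operators

end Manifold

/-- A real vector space with a grading `𝒱` and a bilinear bracket is a graded Lie algebra. -/
structure IsGradedLieAlgebra {V : Type*} [AddCommGroup V] [Module ℝ V] (𝒱 : ℕ → Submodule ℝ V)
    (br : V →ₗ[ℝ] V →ₗ[ℝ] V) : Prop where
  isInternal : DirectSum.IsInternal 𝒱
  mem : ∀ i j, ∀ x ∈ 𝒱 i, ∀ y ∈ 𝒱 j, br x y ∈ 𝒱 (i + j)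
  skew : ∀ i j, ∀ x ∈ 𝒱 i, ∀ y ∈ 𝒱 j, br x y = -((-1 : ℝ) ^ (i * j) • br y x)
  jacobi : ∀ i j k, ∀ x ∈ 𝒱 i, ∀ y ∈ 𝒱 j, ∀ z ∈ 𝒱 k,
    br x (br y z) = br (br x y) z + (-1 : ℝ) ^ (i * j) • br y (br x z)

end FrolicherNijenhuis

end

open FrolicherNijenhuis

noncomputable section

set_option linter.unusedSectionVars false

/-! Everything is read off from the operators `lieD` on Ω(M). Inserting N into differentials of
functions recovers N, and bump functions on a Hausdorff manifold provide functions with any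
prescribed differential at a point; hence Θ is injective in each degree (`lieD_injective`). To
compute a bracket it therefore suffices to exhibit a form of the right degree whose Lie derivative
is the graded commutator (`fnBracket_eq_of_lieTot`). Existence of the bracket is needed, and
established, only when one entry has the form φ ∧ I or is zero.

For φ of degree p and η of degree q one has i_{φ∧I} η = q φ ∧ η, so Θ(φ∧I) η = φ ∧ dη - (-1)^p q dφ
∧ η. Since Θ(K) is a derivation of degree k commuting with d up to sign, the commutator with Θ(φ∧I)
can be worked out (`lieTot_wedgeI_lieD_add`) and gives [K, φ∧I] = Θ(K)φ ∧ I + (-1)^(k(p+1)+p) k dφ ∧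
K.

If dφ = 0, the last term vanishes and Θ(K)φ = ± d i_K φ is exact. So any graded space of closed
forms containing the exact ones yields an ideal, abelian because the bracket of α∧I and β∧I involves
only dα and dβ. For K = α∧I the last term is again a form wedged with I, which gives the subalgebra
and the explicit formula.

Top degree forms play no role because their wedge with I has degree m + 1 and vanishes. Below the
top degree, φ∧I = 0 forces φ∧f = 0 for every covector f; contracting with a basis then gives m φ = k
φ, so φ = 0 (`eq_zero_of_altWedge_id_eq_zero`). Thus u ↦ Θ(u∧I) is faithful on each homogeneous part
of Ω^{*-1}(M), and the graded Lie axioms are inherited from the graded commutator.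

The derivation rules rest on pointwise exterior algebra. Two basis identities carry it: i_K = ∑ (e^j
∘ K) ∧ i_{e_j} (`altInsertTot_eq_sum`) and ∑ e^j ∧ i_{e_j} = k on k-forms
(`sum_covector_wedge_contract`). -/

namespace FrolicherNijenhuis

/-! ### Antisymmetrization over permutations -/

section Permutations

/-- Antisymmetrizing a function of two blocks that is itself antisymmetrized in the first block. -/
theorem sum_perm_sum_perm_left {A B C R : Type*} [Fintype A] [DecidableEq A]
    [Fintype B] [DecidableEq B] [Fintype C] [DecidableEq C] [Ring R]
    (e : A ⊕ B ≃ C) (G : (A → C) → (B → C) → R) :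
    ∑ σ : Equiv.Perm C, ∑ τ : Equiv.Perm A,
        Equiv.Perm.sign σ • Equiv.Perm.sign τ •
          G (fun i => σ (e (.inl (τ i)))) (fun j => σ (e (.inr j))) =
      ((Fintype.card A).factorial : R) * ∑ σ : Equiv.Perm C,
        Equiv.Perm.sign σ • G (fun i => σ (e (.inl i))) (fun j => σ (e (.inr j))) := by
  rw [Finset.sum_comm]
  have key : ∀ τ : Equiv.Perm A, ∑ σ : Equiv.Perm C,
        Equiv.Perm.sign σ • Equiv.Perm.sign τ •
          G (fun i => σ (e (.inl (τ i)))) (fun j => σ (e (.inr j))) =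
      ∑ σ : Equiv.Perm C,
        Equiv.Perm.sign σ • G (fun i => σ (e (.inl i))) (fun j => σ (e (.inr j))) := by
    intro τ
    -- Replacing σ by σ composed with τ⁻¹ on the first block removes τ from the arguments, and the
    -- sign this produces cancels sign τ.
    rw [← Equiv.sum_comp (Equiv.mulRight (e.permCongr (Equiv.Perm.sumCongr τ⁻¹ 1)))]
    refine Finset.sum_congr rfl fun σ _ => ?_
    simp [Equiv.permCongr_apply, mul_smul, smul_smul (Equiv.Perm.sign τ)]
  rw [Finset.sum_congr rfl fun τ _ => key τ, Finset.sum_const, Finset.card_univ,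
    Fintype.card_perm, nsmul_eq_mul]

/-- Antisymmetrizing a function of two blocks that is itself antisymmetrized in the second
block. -/
theorem sum_perm_sum_perm_right {A B C R : Type*} [Fintype A] [DecidableEq A]
    [Fintype B] [DecidableEq B] [Fintype C] [DecidableEq C] [Ring R]
    (e : A ⊕ B ≃ C) (G : (A → C) → (B → C) → R) :
    ∑ σ : Equiv.Perm C, ∑ τ : Equiv.Perm B,
        Equiv.Perm.sign σ • Equiv.Perm.sign τ •
          G (fun i => σ (e (.inl i))) (fun j => σ (e (.inr (τ j)))) =
      ((Fintype.card B).factorial : R) * ∑ σ : Equiv.Perm C,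
        Equiv.Perm.sign σ • G (fun i => σ (e (.inl i))) (fun j => σ (e (.inr j))) :=
  sum_perm_sum_perm_left ((Equiv.sumComm B A).trans e) fun f g => G g f

/-- Writing σ as a transposition of 0 with σ 0 times a permutation of the tail shows, by
antisymmetry of γ, that the left side depends only on σ 0. So σ may be replaced by the inverse cycle
taking 0 to σ 0, which keeps the other entries in order and has sign (-1)^(σ 0). -/
theorem sign_smul_comp_succ {V R : Type*} [AddCommGroup V] [Module ℝ V] [AddCommGroup R]
    [Module ℝ R] {n : ℕ} (γ : V [⋀^Fin n]→ₗ[ℝ] R) (v : Fin (n + 1) → V)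
    (σ : Equiv.Perm (Fin (n + 1))) :
    Equiv.Perm.sign σ • γ (fun j => v (σ j.succ)) =
      (-1 : ℤˣ) ^ (σ 0 : ℕ) • γ ((σ 0).removeNth v) := by
  have key : ∀ τ : Equiv.Perm (Fin (n + 1)),
      Equiv.Perm.sign τ • γ (fun j => v (τ j.succ)) =
        (if τ 0 = 0 then 1 else -1 : ℤˣ) • γ (fun j => v (Equiv.swap 0 (τ 0) j.succ)) := by
    intro τ
    obtain ⟨⟨p, e⟩, rfl⟩ := Equiv.Perm.decomposeFin.symm.surjective τ
    simp only [Equiv.Perm.decomposeFin.symm_sign, Equiv.Perm.decomposeFin_symm_apply_zero,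
      Equiv.Perm.decomposeFin_symm_apply_succ]
    have := γ.map_perm (fun j => v (Equiv.swap 0 p j.succ)) e
    simp only [Function.comp_def] at this
    rw [this, mul_smul, smul_smul (Equiv.Perm.sign e)]
    simp
  rw [key, ← Fin.cycleRange_symm_zero (σ 0), ← key, Fin.cycleRange_symm_zero]
  simp [Fin.sign_cycleRange]
  rfl

end Permutations

/-! ### The exterior algebra of a vector space -/

section FibreAlgebra

variable {V W : Type*} [AddCommGroup V] [Module ℝ V] [TopologicalSpace V]
  [IsTopologicalAddGroup V] [ContinuousSMul ℝ V]
  [AddCommGroup W] [Module ℝ W] [TopologicalSpace W]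
  [IsTopologicalAddGroup W] [ContinuousSMul ℝ W]

variable (V) in
/-- The algebra `⨁_k Λ^k V*` of alternating forms. -/
abbrev AltSum : Type _ := ⨁ k : ℕ, V [⋀^Fin k]→L[ℝ] ℝ

/-- A homogeneous alternating form as an element of `⨁_k Λ^k V*`. -/
abbrev altOf (k : ℕ) : (V [⋀^Fin k]→L[ℝ] ℝ) →ₗ[ℝ] AltSum V :=
  DirectSum.lof ℝ ℕ (fun k => V [⋀^Fin k]→L[ℝ] ℝ) k

/-- Degrees such as (k + l) + r and k + (l + r) give different types. Inside the direct sum the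
forms can be equated without transport, and this reduces such an equation to values. -/
theorem altOf_eq {n n' : ℕ} (h : n = n') {a : V [⋀^Fin n]→L[ℝ] ℝ} {b : V [⋀^Fin n']→L[ℝ] ℝ}
    (hab : ∀ v : Fin n' → V, a (fun i => v (Fin.cast h i)) = b v) : altOf n a = altOf n' b := by
  subst h
  congr 1
  ext v
  exact hab v

variable (V) in
/-- The wedge product on `⨁_k Λ^k V*`. -/
def altWedgeTot : AltSum V →ₗ[ℝ] AltSum V →ₗ[ℝ] AltSum V :=
  DirectSum.toModule ℝ ℕ _ fun k => LinearMap.flip <| DirectSum.toModule ℝ ℕ _ fun l =>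
    ((altWedge k l).compr₂ (altOf (k + l))).flip

theorem altWedgeTot_of {k l : ℕ} (α : V [⋀^Fin k]→L[ℝ] ℝ) (β : V [⋀^Fin l]→L[ℝ] ℝ) :
    altWedgeTot V (altOf k α) (altOf l β) = altOf (k + l) (altWedge k l α β) := by
  simp [altWedgeTot]

theorem AltSum.induction {P : AltSum V → Prop} (a : AltSum V) (h0 : P 0)
    (hof : ∀ k (α : V [⋀^Fin k]→L[ℝ] ℝ), P (altOf k α)) (hadd : ∀ a b, P a → P b → P (a + b)) :
    P a :=
  DirectSum.induction_on a h0 hof hadd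

theorem altWedge_apply_cast {k l N : ℕ} (h : k + l = N) (α : V [⋀^Fin k]→L[ℝ] ℝ)
    (β : V [⋀^Fin l]→L[ℝ] ℝ) (v : Fin N → V) :
    altWedge k l α β (fun i => v (Fin.cast h i)) = ((k.factorial * l.factorial : ℝ)⁻¹) *
      ∑ σ : Equiv.Perm (Fin N), Equiv.Perm.sign σ •
        (α (fun i => v (σ (Fin.cast h (Fin.castAdd l i)))) *
          β (fun j => v (σ (Fin.cast h (Fin.natAdd k j))))) := by
  subst h
  simp [altWedge_apply]

/-- Both bracketings are multiples of one antisymmetrization over three blocks. The inner sums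
contribute (k+l)! and (l+r)!, which cancel against the normalizations and leave 1/(k! l! r!) on
either side. -/
theorem altWedgeTot_assoc (a b c : AltSum V) :
    altWedgeTot V (altWedgeTot V a b) c = altWedgeTot V a (altWedgeTot V b c) := by
  induction a using AltSum.induction with
  | h0 => simp
  | hadd a a' ha ha' => simp [ha, ha']
  | hof k α =>
  induction b using AltSum.induction with
  | h0 => simp
  | hadd a a' ha ha' => simp [ha, ha']
  | hof l β =>
  induction c using AltSum.induction with
  | h0 => simp
  | hadd a a' ha ha' => simp [ha, ha']
  | hof r γ =>
  simp only [altWedgeTot_of]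
  refine altOf_eq (add_assoc k l r) fun v => ?_
  rw [altWedge_apply_cast]
  have h1 := sum_perm_sum_perm_left
    (finSumFinEquiv.trans (finCongr (add_assoc k l r)))
    (fun f g => α (fun i => v (f (Fin.castAdd l i))) * β (fun i => v (f (Fin.natAdd k i)))
      * γ (fun i => v (g i)))
  have h2 := sum_perm_sum_perm_right
    (finSumFinEquiv (m := k) (n := l + r))
    (fun f g => α (fun i => v (f i)) * β (fun i => v (g (Fin.castAdd r i)))
      * γ (fun i => v (g (Fin.natAdd l i))))
  simp only [Equiv.trans_apply, finSumFinEquiv_apply_left, finSumFinEquiv_apply_right,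
    finCongr_apply, Fintype.card_fin] at h1 h2
  have e1 : ∀ σ : Equiv.Perm (Fin (k + (l + r))), Equiv.Perm.sign σ •
      (altWedge k l α β (fun i => v (σ (Fin.cast (add_assoc k l r) (Fin.castAdd r i)))) *
        γ (fun j => v (σ (Fin.cast (add_assoc k l r) (Fin.natAdd (k + l) j))))) =
      ((k.factorial * l.factorial : ℝ)⁻¹) * ∑ τ : Equiv.Perm (Fin (k + l)),
        Equiv.Perm.sign σ • Equiv.Perm.sign τ •
        (α (fun i => v (σ (Fin.cast (add_assoc k l r) (Fin.castAdd r (τ (Fin.castAdd l i)))))) *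
        β (fun i => v (σ (Fin.cast (add_assoc k l r) (Fin.castAdd r (τ (Fin.natAdd k i)))))) *
        γ (fun j => v (σ (Fin.cast (add_assoc k l r) (Fin.natAdd (k + l) j))))) := by
    intro σ
    rw [altWedge_apply]
    simp only [Finset.mul_sum, Finset.sum_mul, Finset.smul_sum, smul_eq_mul, Units.smul_def,
      zsmul_eq_mul]
    refine Finset.sum_congr rfl fun τ _ => ?_
    ring
  have e2 : ∀ σ : Equiv.Perm (Fin (k + (l + r))), Equiv.Perm.sign σ •
      (α (fun i => v (σ (Fin.castAdd (l + r) i))) •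
        altWedge l r β γ (fun j => v (σ (Fin.natAdd k j)))) =
      ((l.factorial * r.factorial : ℝ)⁻¹) * ∑ τ : Equiv.Perm (Fin (l + r)),
        Equiv.Perm.sign σ • Equiv.Perm.sign τ •
        (α (fun i => v (σ (Fin.castAdd (l + r) i))) *
        β (fun i => v (σ (Fin.natAdd k (τ (Fin.castAdd r i))))) *
        γ (fun j => v (σ (Fin.natAdd k (τ (Fin.natAdd l j)))))) := by
    intro σ
    rw [altWedge_apply]
    simp only [Finset.mul_sum, Finset.smul_sum, smul_eq_mul, Units.smul_def,
      zsmul_eq_mul]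
    refine Finset.sum_congr rfl fun τ _ => ?_
    ring
  rw [Finset.sum_congr rfl fun σ _ => e1 σ, ← Finset.mul_sum, h1, altWedge_apply,
    Finset.sum_congr rfl fun σ _ => e2 σ, ← Finset.mul_sum, h2]
  have e3 : ∀ (σ : Equiv.Perm (Fin (k + (l + r)))) (i : Fin l),
      σ (Fin.cast (add_assoc k l r) (Fin.castAdd r (Fin.natAdd k i))) =
        σ (Fin.natAdd k (Fin.castAdd r i)) := fun σ i => rfl
  have e4 : ∀ (σ : Equiv.Perm (Fin (k + (l + r)))) (i : Fin r),
      σ (Fin.cast (add_assoc k l r) (Fin.natAdd (k + l) i)) =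
        σ (Fin.natAdd k (Fin.natAdd l i)) := by
    intro σ i
    congr 1
    ext
    simp [add_assoc]
  have e5 : ∀ (σ : Equiv.Perm (Fin (k + (l + r)))) (i : Fin k),
      σ (Fin.cast (add_assoc k l r) (Fin.castAdd r (Fin.castAdd l i))) =
        σ (Fin.castAdd (l + r) i) := fun σ i => rfl
  simp only [e3, e4, e5]
  set S := ∑ σ : Equiv.Perm (Fin (k + (l + r))), Equiv.Perm.sign σ •
        (α (fun i => v (σ (Fin.castAdd (l + r) i))) *
        β (fun i => v (σ (Fin.natAdd k (Fin.castAdd r i)))) *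
        γ (fun j => v (σ (Fin.natAdd k (Fin.natAdd l j)))))
  have f1 := Nat.factorial_ne_zero k
  have f2 := Nat.factorial_ne_zero l
  have f3 := Nat.factorial_ne_zero r
  have f4 := Nat.factorial_ne_zero (k + l)
  have f5 := Nat.factorial_ne_zero (l + r)
  simp only [smul_eq_mul]
  field_simp

/-- The alternating form of degree zero with value `c`. -/
abbrev altConst (c : ℝ) : V [⋀^Fin 0]→L[ℝ] ℝ := .constOfIsEmpty ℝ V (Fin 0) c

/-- A linear form as an alternating form of degree one. -/
abbrev altCovector (f : V →L[ℝ] ℝ) : V [⋀^Fin 1]→L[ℝ] ℝ :=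
  ContinuousAlternatingMap.ofSubsingleton ℝ V ℝ (0 : Fin 1) f

theorem altWedgeTot_const_left (c : ℝ) (b : AltSum V) :
    altWedgeTot V (altOf 0 (altConst c)) b = c • b := by
  induction b using AltSum.induction with
  | h0 => simp
  | hadd a a' ha ha' => simp [ha, ha']
  | hof l β =>
  rw [altWedgeTot_of, ← map_smul]
  refine altOf_eq (zero_add l) fun v => ?_
  rw [altWedge_apply_cast]
  -- By antisymmetry all l! summands coincide, which cancels the normalization 1/(0! l!).
  have : ∀ σ : Equiv.Perm (Fin l), Equiv.Perm.sign σ •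
      ((altConst c : V [⋀^Fin 0]→L[ℝ] ℝ)
          (fun i => v (σ (Fin.cast (zero_add l) (Fin.castAdd l i)))) *
        β (fun j => v (σ (Fin.cast (zero_add l) (Fin.natAdd 0 j))))) = c * β v := by
    intro σ
    have h := β.toAlternatingMap.map_perm v σ
    simp only [ContinuousAlternatingMap.coe_toAlternatingMap, Function.comp_def] at h
    have h' : (fun j => v (σ (Fin.cast (zero_add l) (Fin.natAdd 0 j)))) = fun j => v (σ j) := by
      funext j
      congr 2
      ext
      simp
    rw [h', h]
    rcases Int.units_eq_one_or (Equiv.Perm.sign σ) with h | h <;> simp [h]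
  rw [Finset.sum_congr rfl fun σ _ => this σ]
  simp [Fintype.card_perm]
  have := Nat.factorial_ne_zero l
  field_simp

theorem altWedgeTot_const_right (c : ℝ) (b : AltSum V) :
    altWedgeTot V b (altOf 0 (altConst c)) = c • b := by
  induction b using AltSum.induction with
  | h0 => simp
  | hadd a a' ha ha' => simp [ha, ha']
  | hof l β =>
  rw [altWedgeTot_of, ← map_smul]
  refine altOf_eq (add_zero l) fun v => ?_
  rw [altWedge_apply_cast]
  have : ∀ σ : Equiv.Perm (Fin l), Equiv.Perm.sign σ •
      (β (fun j => v (σ (Fin.cast (add_zero l) (Fin.castAdd 0 j)))) *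
        (altConst c : V [⋀^Fin 0]→L[ℝ] ℝ)
          (fun i => v (σ (Fin.cast (add_zero l) (Fin.natAdd l i))))) = c * β v := by
    intro σ
    have h := β.toAlternatingMap.map_perm v σ
    simp only [ContinuousAlternatingMap.coe_toAlternatingMap, Function.comp_def] at h
    have h' : (fun j => v (σ (Fin.cast (add_zero l) (Fin.castAdd 0 j)))) = fun j => v (σ j) := rfl
    rw [h', h]
    rcases Int.units_eq_one_or (Equiv.Perm.sign σ) with h | h <;> simp [h, mul_comm]
  rw [Finset.sum_congr rfl fun σ _ => this σ]
  simp [Fintype.card_perm]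
  have := Nat.factorial_ne_zero l
  field_simp

theorem eq_altConst (α : V [⋀^Fin 0]→L[ℝ] ℝ) : α = altConst (α 0) := by
  ext v
  rw [Subsingleton.elim v 0]
  rfl

/-- A summand depends on σ only through σ 0, and every value of σ 0 occurs n! times, cancelling the
normalization 1/(1! n!). -/
theorem altWedge_covector_apply {n : ℕ} (f : V →L[ℝ] ℝ) (γ : V [⋀^Fin n]→L[ℝ] ℝ)
    (v : Fin (n + 1) → V) :
    altWedge 1 n (altCovector f) γ (fun i => v (Fin.cast (add_comm 1 n) i)) =
      ∑ i : Fin (n + 1), (-1) ^ (i : ℕ) * (f (v i) * γ (i.removeNth v)) := by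
  rw [altWedge_apply_cast]
  have h0 : ∀ i : Fin 1, Fin.cast (add_comm 1 n) (Fin.castAdd n i) = 0 := by
    intro i
    ext
    simp
  have h1 : ∀ j : Fin n, Fin.cast (add_comm 1 n) (Fin.natAdd 1 j) = j.succ := by
    intro j
    ext
    simp
  have h2 : ∀ σ : Equiv.Perm (Fin (n + 1)), Equiv.Perm.sign σ •
      (altCovector f (fun i => v (σ (Fin.cast (add_comm 1 n) (Fin.castAdd n i)))) *
        γ (fun j => v (σ (Fin.cast (add_comm 1 n) (Fin.natAdd 1 j))))) =
      (-1) ^ (σ 0 : ℕ) * (f (v (σ 0)) * γ ((σ 0).removeNth v)) := by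
    intro σ
    simp only [h0, h1]
    have := sign_smul_comp_succ γ.toAlternatingMap v σ
    simp only [ContinuousAlternatingMap.coe_toAlternatingMap] at this
    rw [← mul_smul_comm, this]
    simp [Units.smul_def]
    ring
  rw [Finset.sum_congr rfl fun σ _ => h2 σ, ← Equiv.sum_comp Equiv.Perm.decomposeFin.symm,
    Fintype.sum_prod_type]
  simp only [Equiv.Perm.decomposeFin_symm_apply_zero, Finset.sum_const, Finset.card_univ,
    Fintype.card_perm, Fintype.card_fin, nsmul_eq_mul]
  rw [← Finset.mul_sum]
  have := Nat.factorial_ne_zero n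
  simp
  field_simp

end FibreAlgebra

/-! ### Contraction and insertion -/

section Contraction

variable {V : Type*} [AddCommGroup V] [Module ℝ V] [TopologicalSpace V]
  [IsTopologicalAddGroup V] [ContinuousSMul ℝ V]

/-- Insertion of the vector `e` into the first slot of an alternating form. -/
def altContract (e : V) (q : ℕ) : (V [⋀^Fin (q + 1)]→L[ℝ] ℝ) →ₗ[ℝ] (V [⋀^Fin q]→L[ℝ] ℝ) where
  toFun α :=
    { α.toAlternatingMap.curryLeft e with
      cont := α.cont.comp (continuous_pi fun j => by
        induction j using Fin.cases with
        | zero => exact continuous_const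
        | succ j => exact continuous_apply j) }
  map_add' _ _ := rfl
  map_smul' _ _ := rfl

theorem altContract_apply (e : V) (q : ℕ) (α : V [⋀^Fin (q + 1)]→L[ℝ] ℝ) (v : Fin q → V) :
    altContract e q α v = α (Fin.cons e v) := rfl

/-- An alternating form as a linear function of its first argument. -/
def altConsL {q : ℕ} (α : V [⋀^Fin (q + 1)]→L[ℝ] ℝ) (w : Fin q → V) : V →ₗ[ℝ] ℝ where
  toFun x := α (Fin.cons x w)
  map_add' x y := α.cons_add w x y
  map_smul' c x := α.cons_smul w c x

/-- Insertion of a vector, as an operator on `⨁_k Λ^k V*` that vanishes in degree zero. -/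
def altContractTot (e : V) : AltSum V →ₗ[ℝ] AltSum V :=
  DirectSum.toModule ℝ ℕ _ fun q =>
    match q with
    | 0 => 0
    | q + 1 => (altOf q).comp (altContract e q)

theorem altContractTot_of_zero (e : V) (α : V [⋀^Fin 0]→L[ℝ] ℝ) :
    altContractTot e (altOf 0 α) = 0 := by
  simp [altContractTot]

theorem altContractTot_of_succ (e : V) {q : ℕ} (α : V [⋀^Fin (q + 1)]→L[ℝ] ℝ) :
    altContractTot e (altOf (q + 1) α) = altOf q (altContract e q α) := by
  simp [altContractTot]

/-- Insertion of a vector valued form, as an operator on `⨁_k Λ^k V*` that vanishes in degree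
zero. -/
def altInsertTot {k : ℕ} (K : V [⋀^Fin k]→L[ℝ] V) : AltSum V →ₗ[ℝ] AltSum V :=
  DirectSum.toModule ℝ ℕ _ fun q =>
    match q with
    | 0 => 0
    | q + 1 => (altOf (k + q)).comp (altInsert k q K)

theorem altInsertTot_of_zero {k : ℕ} (K : V [⋀^Fin k]→L[ℝ] V) (α : V [⋀^Fin 0]→L[ℝ] ℝ) :
    altInsertTot K (altOf 0 α) = 0 := by
  simp [altInsertTot]

theorem altInsertTot_of_succ {k q : ℕ} (K : V [⋀^Fin k]→L[ℝ] V) (α : V [⋀^Fin (q + 1)]→L[ℝ] ℝ) :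
    altInsertTot K (altOf (q + 1) α) = altOf (k + q) (altInsert k q K α) := by
  simp [altInsertTot]

theorem exists_altOf_cast {n n' : ℕ} (h : n = n') (α : V [⋀^Fin n]→L[ℝ] ℝ) :
    ∃ β : V [⋀^Fin n']→L[ℝ] ℝ, altOf n α = altOf n' β ∧
      ∀ v, β v = α (fun i => v (Fin.cast h i)) := by
  subst h
  exact ⟨α, rfl, fun v => rfl⟩

theorem exists_covector_wedge {n : ℕ} (f : V →L[ℝ] ℝ) (γ : V [⋀^Fin n]→L[ℝ] ℝ) :
    ∃ β : V [⋀^Fin (n + 1)]→L[ℝ] ℝ,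
      altWedgeTot V (altOf 1 (altCovector f)) (altOf n γ) = altOf (n + 1) β ∧
      ∀ v, β v = ∑ i : Fin (n + 1), (-1) ^ (i : ℕ) * (f (v i) * γ (i.removeNth v)) := by
  obtain ⟨β, h, hβ⟩ := exists_altOf_cast (add_comm 1 n) (altWedge 1 n (altCovector f) γ)
  exact ⟨β, by rw [altWedgeTot_of, h], fun v => by rw [hβ, altWedge_covector_apply]⟩

/-- In the expansion of f ∧ b with e in slot zero, the term i = 0 is f(e) b. Every other term keeps
e in the first slot of b, and its sign changes because the index shifts by one. -/
theorem altContractTot_covector_wedge (e : V) (f : V →L[ℝ] ℝ) (b : AltSum V) :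
    altContractTot e (altWedgeTot V (altOf 1 (altCovector f)) b) =
      f e • b + (-1 : ℝ) • altWedgeTot V (altOf 1 (altCovector f)) (altContractTot e b) := by
  induction b using AltSum.induction with
  | h0 => simp
  | hadd a a' ha ha' =>
    simp only [map_add, ha, ha', smul_add]
    abel
  | hof n γ =>
  cases n with
  | zero =>
    rw [eq_altConst γ]
    generalize γ 0 = c
    rw [altWedgeTot_const_right, altContractTot_of_zero, map_smul,
      altContractTot_of_succ, map_zero, smul_zero, add_zero, ← map_smul (altOf 0) c,
      ← map_smul (altOf 0) (f e)]
    congr 1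
    ext v
    simp [altContract_apply, mul_comm]
  | succ n =>
    obtain ⟨X, hX, hXv⟩ := exists_covector_wedge f γ
    obtain ⟨Y, hY, hYv⟩ := exists_covector_wedge f (altContract e n γ)
    rw [hX, altContractTot_of_succ, altContractTot_of_succ, hY, ← map_smul, ← map_smul, ← map_add]
    congr 1
    ext v
    rw [altContract_apply, hXv, Fin.sum_univ_succ]
    simp only [ContinuousAlternatingMap.add_apply, ContinuousAlternatingMap.smul_apply, hYv,
      Finset.smul_sum]
    congr 1
    · simp
    · refine Finset.sum_congr rfl fun i _ => ?_
      have : (Fin.succ i).removeNth (Fin.cons e v : Fin (n + 2) → V) =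
          Fin.cons e (i.removeNth v) := by
        funext j
        induction j using Fin.cases <;> simp [Fin.removeNth]
      rw [altContract_apply]
      erw [this]
      simp [pow_succ]

theorem altWedge_id_comp {k l : ℕ} (α : V [⋀^Fin k]→L[ℝ] ℝ) (K : V [⋀^Fin l]→L[ℝ] V)
    (h : V →L[ℝ] ℝ) :
    h.compContinuousAlternatingMap (altWedge k l α K) =
      altWedge k l α (h.compContinuousAlternatingMap K) := by
  ext v
  simp [altWedge_apply, map_sum, Units.smul_def]

/-! ### Expansions in a basis -/

section Basis

variable {ι : Type*} [Fintype ι] (b : Module.Basis ι ℝ V) [T2Space V]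

/-- The continuous coordinate functions of a basis. -/
def coordL [Finite ι] (b : Module.Basis ι ℝ V) (j : ι) : V →L[ℝ] ℝ :=
  haveI := b.finiteDimensional_of_finite
  LinearMap.toContinuousLinearMap (b.coord j)

theorem coordL_apply (j : ι) (v : V) : coordL b j v = b.repr v j := rfl

theorem sum_coordL_smul (v : V) : ∑ j, coordL b j v • b j = v := b.sum_repr v

theorem sum_coordL_mul (g : V →ₗ[ℝ] ℝ) (v : V) : ∑ j, coordL b j v * g (b j) = g v := by
  conv_rhs => rw [← sum_coordL_smul b v]
  simp

/-- Euler's identity. Each slot i of the expansion contributes α v once: summing over the basis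
rebuilds v i in the first slot, and moving it back to slot i costs (-1)^i, which cancels the sign in
the expansion. -/
theorem sum_covector_wedge_contract {k : ℕ} (α : V [⋀^Fin k]→L[ℝ] ℝ) :
    ∑ j, altWedgeTot V (altOf 1 (altCovector (coordL b j))) (altContractTot (b j) (altOf k α)) =
      (k : ℝ) • altOf k α := by
  cases k with
  | zero => simp [altContractTot_of_zero]
  | succ k =>
    choose Y hY hYv using fun j => exists_covector_wedge (coordL b j) (altContract (b j) k α)
    simp only [altContractTot_of_succ, hY]
    rw [← map_sum, ← map_smul]
    congr 1
    ext v
    simp only [ContinuousAlternatingMap.sum_apply, hYv, altContract_apply,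
      ContinuousAlternatingMap.smul_apply]
    rw [Finset.sum_comm]
    have : ∀ i : Fin (k + 1), ∑ j, (-1 : ℝ) ^ (i : ℕ) *
        (coordL b j (v i) * α (Fin.cons (b j) (i.removeNth v))) = α v := by
      intro i
      have h1 : ∑ j, coordL b j (v i) * α (Fin.cons (b j) (i.removeNth v)) =
          α (Fin.cons (v i) (i.removeNth v)) :=
        sum_coordL_mul b (altConsL α (i.removeNth v)) (v i)
      rw [← Finset.mul_sum, h1]
      have h2 := α.toAlternatingMap.neg_one_pow_smul_map_insertNth i (v i) (i.removeNth v)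
      rw [Fin.insertNth_self_removeNth] at h2
      have h3 : α (Fin.cons (v i) (i.removeNth v)) = (-1) ^ (i : ℕ) • α v := h2.symm
      rw [h3, zsmul_eq_mul, ← mul_assoc]
      push_cast
      rw [← mul_pow]
      simp
    rw [Finset.sum_congr rfl fun i _ => this i]
    simp

/-- Since K = ∑ (e^j ∘ K) ⊗ e_j, this is the defining rule i_{φ⊗X} ω = φ ∧ i_X ω extended by
linearity. It reduces insertion of K to wedge products and contraction with vectors. -/
theorem altInsertTot_eq_sum {k : ℕ} (K : V [⋀^Fin k]→L[ℝ] V) (a : AltSum V) :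
    altInsertTot K a = ∑ j, altWedgeTot V
      (altOf k ((coordL b j).compContinuousAlternatingMap K)) (altContractTot (b j) a) := by
  induction a using AltSum.induction with
  | h0 => simp
  | hadd a a' ha ha' => simp [ha, ha', Finset.sum_add_distrib]
  | hof q α =>
  cases q with
  | zero => simp [altContractTot_of_zero, altInsertTot_of_zero]
  | succ q =>
    simp only [altContractTot_of_succ, altInsertTot_of_succ, altWedgeTot_of]
    rw [← map_sum]
    congr 1
    ext v
    simp only [ContinuousAlternatingMap.sum_apply, altInsert_apply, altWedge_apply,
      altContract_apply]
    rw [← Finset.smul_sum, Finset.sum_comm]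
    congr 1
    refine Finset.sum_congr rfl fun σ _ => ?_
    rw [← Finset.smul_sum]
    congr 1
    exact (sum_coordL_mul b (altConsL α fun j => v (σ (Fin.natAdd k j)))
      (K fun i => v (σ (Fin.castAdd q i)))).symm

end Basis

/-! ### Graded commutativity and derivation rules -/

variable [FiniteDimensional ℝ V] [T2Space V]

/-- Every alternating form is a sum of wedge products of linear forms. -/
theorem altOf_induction {P : ℕ → AltSum V → Prop} (hconst : ∀ c, P 0 (altOf 0 (altConst c)))
    (hzero : ∀ k, P k 0) (hadd : ∀ k a b, P k a → P k b → P k (a + b))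
    (hstep : ∀ k (f : V →L[ℝ] ℝ) (α : V [⋀^Fin k]→L[ℝ] ℝ), P k (altOf k α) →
      P (k + 1) (altWedgeTot V (altOf 1 (altCovector f)) (altOf k α)))
    (k : ℕ) (α : V [⋀^Fin k]→L[ℝ] ℝ) : P k (altOf k α) := by
  induction k with
  | zero =>
    rw [eq_altConst α]
    exact hconst _
  | succ k ih =>
    -- Euler's identity for α / (k + 1) writes α itself as a sum of covectors wedged with k-forms.
    have h := sum_covector_wedge_contract (Module.finBasis ℝ V) (((k + 1 : ℝ)⁻¹) • α)
    rw [map_smul (altOf (k + 1)), smul_smul] at h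
    have hk : ((k + 1 : ℕ) : ℝ) * (k + 1 : ℝ)⁻¹ = 1 := by
      push_cast
      exact mul_inv_cancel₀ (by positivity)
    rw [hk, one_smul] at h
    rw [← h]
    refine Finset.sum_induction _ (P (k + 1)) (hadd _) (hzero _) fun j _ => ?_
    rw [← map_smul (altOf (k + 1)), altContractTot_of_succ]
    exact hstep _ _ _ (ih _)

theorem altContractTot_wedge (e : V) {k : ℕ} (α : V [⋀^Fin k]→L[ℝ] ℝ) (b : AltSum V) :
    altContractTot e (altWedgeTot V (altOf k α) b) =
      altWedgeTot V (altContractTot e (altOf k α)) b +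
        (-1 : ℝ) ^ k • altWedgeTot V (altOf k α) (altContractTot e b) := by
  revert b
  refine altOf_induction (P := fun k a => ∀ b, altContractTot e (altWedgeTot V a b) =
      altWedgeTot V (altContractTot e a) b +
        (-1 : ℝ) ^ k • altWedgeTot V a (altContractTot e b)) ?_ ?_ ?_ ?_ k α
  · intro c b
    simp [altWedgeTot_const_left, altContractTot_of_zero]
  · intro k b
    simp
  · intro k a a' ha ha' b
    simp only [map_add, LinearMap.add_apply, ha, ha', smul_add]
    abel
  · intro k f α ih b
    rw [altWedgeTot_assoc, altContractTot_covector_wedge, ih, altContractTot_covector_wedge]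
    simp only [map_add, map_smul, LinearMap.add_apply, LinearMap.smul_apply,
      altWedgeTot_assoc, pow_succ]
    module

theorem covector_wedge_covector (f g : V →L[ℝ] ℝ) :
    altWedgeTot V (altOf 1 (altCovector f)) (altOf 1 (altCovector g)) =
      (-1 : ℝ) • altWedgeTot V (altOf 1 (altCovector g)) (altOf 1 (altCovector f)) := by
  obtain ⟨X, hX, hXv⟩ := exists_covector_wedge f (altCovector g)
  obtain ⟨Y, hY, hYv⟩ := exists_covector_wedge g (altCovector f)
  rw [hX, hY, ← map_smul]
  congr 1
  ext v
  rw [ContinuousAlternatingMap.smul_apply, hXv, hYv]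
  simp [Fin.sum_univ_two, Fin.removeNth]
  ring

theorem covector_wedge_comm (f : V →L[ℝ] ℝ) {l : ℕ} (β : V [⋀^Fin l]→L[ℝ] ℝ) :
    altWedgeTot V (altOf 1 (altCovector f)) (altOf l β) =
      (-1 : ℝ) ^ l • altWedgeTot V (altOf l β) (altOf 1 (altCovector f)) := by
  refine altOf_induction (P := fun l b => altWedgeTot V (altOf 1 (altCovector f)) b =
      (-1 : ℝ) ^ l • altWedgeTot V b (altOf 1 (altCovector f))) ?_ ?_ ?_ ?_ l β
  · intro c
    simp [altWedgeTot_const_left, altWedgeTot_const_right]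
  · simp
  · intro k a b ha hb
    simp [ha, hb]
  · intro l g β ih
    rw [← altWedgeTot_assoc, covector_wedge_covector, map_smul, LinearMap.smul_apply,
      altWedgeTot_assoc, ih, altWedgeTot_assoc, map_smul, pow_succ]
    module

/-- Covectors anticommute; building up one factor from covectors gives the case of a covector and a
form, and building up the other gives the general case. -/
theorem altWedgeTot_comm {k l : ℕ} (α : V [⋀^Fin k]→L[ℝ] ℝ) (β : V [⋀^Fin l]→L[ℝ] ℝ) :
    altWedgeTot V (altOf k α) (altOf l β) =
      (-1 : ℝ) ^ (k * l) • altWedgeTot V (altOf l β) (altOf k α) := by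
  refine altOf_induction (P := fun k a => altWedgeTot V a (altOf l β) =
      (-1 : ℝ) ^ (k * l) • altWedgeTot V (altOf l β) a) ?_ ?_ ?_ ?_ k α
  · intro c
    simp [altWedgeTot_const_left, altWedgeTot_const_right]
  · simp
  · intro k a b ha hb
    simp [ha, hb]
  · intro k f α ih
    rw [altWedgeTot_assoc, ih, map_smul, ← altWedgeTot_assoc, covector_wedge_comm, map_smul,
      LinearMap.smul_apply, smul_smul, altWedgeTot_assoc, ← pow_add]
    congr 2
    ring

/-- Insertion of a vector valued form of degree `k` is a graded derivation of degree `k - 1`. -/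
theorem altInsertTot_wedge {k p : ℕ} (K : V [⋀^Fin k]→L[ℝ] V) (α : V [⋀^Fin p]→L[ℝ] ℝ)
    (b : AltSum V) :
    altInsertTot K (altWedgeTot V (altOf p α) b) =
      altWedgeTot V (altInsertTot K (altOf p α)) b +
        (-1 : ℝ) ^ ((k + 1) * p) • altWedgeTot V (altOf p α) (altInsertTot K b) := by
  simp only [altInsertTot_eq_sum (Module.finBasis ℝ V), map_sum, LinearMap.sum_apply,
    Finset.smul_sum, ← Finset.sum_add_distrib]
  refine Finset.sum_congr rfl fun j _ => ?_
  set κ := (coordL (Module.finBasis ℝ V) j).compContinuousAlternatingMap K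
  -- Moving the coefficient form of degree k past α gives (-1)^(kp). With the sign (-1)^p of the
  -- contraction this makes (-1)^((k+1)p).
  have h : ∀ x, altWedgeTot V (altOf k κ) (altWedgeTot V (altOf p α) x) =
      (-1 : ℝ) ^ (k * p) • altWedgeTot V (altOf p α) (altWedgeTot V (altOf k κ) x) := fun x => by
    rw [← altWedgeTot_assoc, altWedgeTot_comm, map_smul, LinearMap.smul_apply, altWedgeTot_assoc]
  rw [altContractTot_wedge, map_add, map_smul, h, altWedgeTot_assoc, smul_smul, ← pow_add]
  congr 3
  ring

theorem altInsertTot_altWedge {k l : ℕ} (φ : V [⋀^Fin k]→L[ℝ] ℝ) (K : V [⋀^Fin l]→L[ℝ] V)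
    (a : AltSum V) :
    altInsertTot (altWedge k l φ K) a = altWedgeTot V (altOf k φ) (altInsertTot K a) := by
  simp only [altInsertTot_eq_sum (Module.finBasis ℝ V), map_sum, altWedge_id_comp,
    ← altWedgeTot_of, altWedgeTot_assoc]

/-- The coefficient forms of the identity are the coordinate covectors, so the basis expansion of
the insertion is the left side of Euler's identity. -/
theorem altInsertTot_id {k : ℕ} (α : V [⋀^Fin k]→L[ℝ] ℝ) :
    altInsertTot (ContinuousAlternatingMap.ofSubsingleton ℝ V V (0 : Fin 1)
      (ContinuousLinearMap.id ℝ V)) (altOf k α) = (k : ℝ) • altOf k α := by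
  rw [altInsertTot_eq_sum (Module.finBasis ℝ V),
    ← sum_covector_wedge_contract (Module.finBasis ℝ V)]
  rfl

end Contraction

/-! ### Pullback of alternating forms -/

section Pullback

variable {V W : Type*} [AddCommGroup V] [Module ℝ V] [TopologicalSpace V]
  [IsTopologicalAddGroup V] [ContinuousSMul ℝ V]
  [AddCommGroup W] [Module ℝ W] [TopologicalSpace W]
  [IsTopologicalAddGroup W] [ContinuousSMul ℝ W]

/-- Pullback of alternating forms along a linear map. -/
def altPull (g : W →L[ℝ] V) : AltSum V →ₗ[ℝ] AltSum W :=
  DirectSum.toModule ℝ ℕ _ fun k =>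
    (altOf k).comp (ContinuousAlternatingMap.compContinuousLinearMapₗ g)

theorem altPull_of (g : W →L[ℝ] V) {k : ℕ} (α : V [⋀^Fin k]→L[ℝ] ℝ) :
    altPull g (altOf k α) = altOf k (α.compContinuousLinearMap g) := by
  simp [altPull]

theorem altPull_wedge (g : W →L[ℝ] V) (a b : AltSum V) :
    altPull g (altWedgeTot V a b) = altWedgeTot W (altPull g a) (altPull g b) := by
  induction a using AltSum.induction with
  | h0 => simp
  | hadd a a' ha ha' => simp [ha, ha']
  | hof k α =>
  induction b using AltSum.induction with
  | h0 => simp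
  | hadd a a' ha ha' => simp [ha, ha']
  | hof l β =>
  simp only [altWedgeTot_of, altPull_of, altWedge_comp_right]

end Pullback

/-! ### The exterior derivative on a vector space -/

section ExtDeriv

variable {E : Type*} [NormedAddCommGroup E] [NormedSpace ℝ E] [FiniteDimensional ℝ E]

/-- With L the derivative of a form this is d = ∑ e^j ∧ ∂_j, so the Leibniz rule for d follows from
the one for the partial derivatives. -/
theorem altOf_alternatizeUncurryFin {ι : Type*} [Fintype ι] (b : Module.Basis ι ℝ E) {n : ℕ}
    (L : E →L[ℝ] E [⋀^Fin n]→L[ℝ] ℝ) :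
    altOf (n + 1) (ContinuousAlternatingMap.alternatizeUncurryFin L) =
      ∑ j, altWedgeTot E (altOf 1 (altCovector (coordL b j))) (altOf n (L (b j))) := by
  choose Y hY hYv using fun j => exists_covector_wedge (coordL b j) (L (b j))
  simp only [hY]
  rw [← map_sum]
  congr 1
  ext v
  simp only [ContinuousAlternatingMap.sum_apply, hYv,
    ContinuousAlternatingMap.alternatizeUncurryFin_apply]
  rw [Finset.sum_comm]
  refine Finset.sum_congr rfl fun i _ => ?_
  rw [← Finset.mul_sum]
  have h : ∑ j, coordL b j (v i) * L (b j) (i.removeNth v) = L (v i) (i.removeNth v) := by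
    conv_rhs => rw [← sum_coordL_smul b (v i)]
    simp
  rw [h, zsmul_eq_mul]
  push_cast
  rfl

/-- The Leibniz rule for the exterior derivative. -/
theorem extDeriv_altWedge {k l : ℕ} {a : E → E [⋀^Fin k]→L[ℝ] ℝ} {b : E → E [⋀^Fin l]→L[ℝ] ℝ}
    {y : E} (ha : DifferentiableAt ℝ a y) (hb : DifferentiableAt ℝ b y) :
    altOf (k + l + 1) (extDeriv (fun z => altWedge k l (a z) (b z)) y) =
      altWedgeTot E (altOf (k + 1) (extDeriv a y)) (altOf l (b y)) +
        (-1 : ℝ) ^ k • altWedgeTot E (altOf k (a y)) (altOf (l + 1) (extDeriv b y)) := by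
  have := finiteDimensional_alt (E := E) (F := ℝ) k
  have := finiteDimensional_alt (E := E) (F := ℝ) l
  have hd : ∀ v, fderiv ℝ (fun z => altWedge k l (a z) (b z)) y v =
      altWedge k l (fderiv ℝ a y v) (b y) + altWedge k l (a y) (fderiv ℝ b y v) := by
    intro v
    have h := ContinuousLinearMap.hasFDerivAt_of_bilinear
      ((altWedge (V := E) (F := ℝ) k l).toContinuousBilinearMap) ha.hasFDerivAt hb.hasFDerivAt
    have h' := h.fderiv
    have h'' := congrArg (fun g => g v) h'
    simp at h''
    exact h''.trans (add_comm _ _)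
  simp only [extDeriv]
  rw [altOf_alternatizeUncurryFin (Module.finBasis ℝ E),
    altOf_alternatizeUncurryFin (Module.finBasis ℝ E),
    altOf_alternatizeUncurryFin (Module.finBasis ℝ E)]
  simp only [hd, map_sum, LinearMap.sum_apply, Finset.smul_sum, ← Finset.sum_add_distrib]
  refine Finset.sum_congr rfl fun j _ => ?_
  rw [map_add, map_add, ← altWedgeTot_of, ← altWedgeTot_of, altWedgeTot_assoc,
    ← altWedgeTot_assoc (altOf k (a y)), altWedgeTot_comm (a y) (altCovector _), map_smul,
    LinearMap.smul_apply,
    smul_smul, ← pow_add, altWedgeTot_assoc]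
  congr 1
  -- The exponent is k + k · 1: the sign in the Leibniz rule cancels the one from moving e^j past a.
  rw [Even.neg_one_pow (by simp), one_smul]

end ExtDeriv

/-! ### From fibres and charts to forms on the manifold -/

section Evaluation

variable {m : ℕ} {M : Type*} [TopologicalSpace M] [ChartedSpace (EuclideanSpace ℝ (Fin m)) M]
  [IsManifold (𝓡 m) ∞ M]

instance (x : M) : FiniteDimensional ℝ (TangentSpace (𝓡 m) x) :=
  inferInstanceAs (FiniteDimensional ℝ (Euc m))

instance (x : M) : T2Space (TangentSpace (𝓡 m) x) :=
  inferInstanceAs (T2Space (Euc m))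

/-- The value at a point of a homogeneous form. -/
def Form.evalₗ (k : ℕ) (x : M) : Form m M k →ₗ[ℝ] (TangentSpace (𝓡 m) x [⋀^Fin k]→L[ℝ] ℝ) where
  toFun α := α.1 x
  map_add' _ _ := rfl
  map_smul' _ _ := rfl

/-- The value at a point of a form. -/
def formEval (x : M) : Forms m M →ₗ[ℝ] AltSum (TangentSpace (𝓡 m) x) :=
  DirectSum.toModule ℝ ℕ _ fun k => (altOf k).comp (Form.evalₗ k x)

theorem formEval_of {k : ℕ} (x : M) (α : Form m M k) :
    formEval x α.toForms = altOf k (α.1 x) := by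
  simp [formEval]
  rfl

theorem Forms.induction {P : Forms m M → Prop} (a : Forms m M) (h0 : P 0)
    (hof : ∀ k (α : Form m M k), P α.toForms) (hadd : ∀ a b, P a → P b → P (a + b)) : P a :=
  DirectSum.induction_on a h0 hof hadd

theorem Form.toForms_apply_self {k : ℕ} (α : Form m M k) : α.toForms k = α :=
  DirectSum.lof_apply ..

theorem Form.toForms_apply_ne {k l : ℕ} (α : Form m M k) (h : k ≠ l) : α.toForms l = 0 :=
  DirectSum.of_eq_of_ne _ _ _ h.symm

theorem formEval_apply (x : M) (a : Forms m M) (k : ℕ) : formEval x a k = (a k).1 x := by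
  induction a using Forms.induction with
  | h0 => rw [map_zero]; rfl
  | hadd a b ha hb => rw [map_add, DirectSum.add_apply, ha, hb]; rfl
  | hof l α =>
    rw [formEval_of]
    by_cases h : l = k
    · subst h
      rw [Form.toForms_apply_self, DirectSum.lof_apply]
    · rw [Form.toForms_apply_ne _ h, DirectSum.lof_eq_of, DirectSum.of_eq_of_ne _ _ _ (Ne.symm h)]
      rfl

/-- Identities that involve no derivatives can thus be checked in the exterior algebra of each
cotangent space. -/
theorem Forms.ext_eval {a b : Forms m M} (h : ∀ x, formEval x a = formEval x b) : a = b := by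
  refine DFinsupp.ext fun k => Subtype.ext (funext fun x => ?_)
  have := congrArg (fun c => c k) (h x)
  simpa only [formEval_apply] using this

theorem wedgeTot_of {k l : ℕ} (α : Form m M k) (β : Form m M l) :
    wedgeTot m M α.toForms β.toForms = (wedge k l α β).toForms := by
  simp [wedgeTot]

theorem insTot_of_zero {k : ℕ} (K : VForm m M k) (α : Form m M 0) : insTot K α.toForms = 0 := by
  simp [insTot]

theorem insTot_of_succ {k q : ℕ} (K : VForm m M k) (α : Form m M (q + 1)) :
    insTot K α.toForms = (insertion k q K α).toForms := by
  simp [insTot]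

theorem dTot_of {k : ℕ} (α : Form m M k) : dTot m M α.toForms = (extD k α).toForms := by
  simp [dTot]

theorem wedgeI_of {k : ℕ} (α : Form m M k) :
    wedgeI m M α.toForms = (wedgeV k 1 α (idForm m M)).toVForms := by
  simp [wedgeI]

theorem formEval_wedgeTot (x : M) (a b : Forms m M) :
    formEval x (wedgeTot m M a b) = altWedgeTot _ (formEval x a) (formEval x b) := by
  induction a using Forms.induction with
  | h0 => simp
  | hadd a a' ha ha' => simp only [map_add, LinearMap.add_apply, ha, ha']
  | hof k α =>
  induction b using Forms.induction with
  | h0 => simp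
  | hadd a a' ha ha' => simp only [map_add, ha, ha']
  | hof l β =>
  rw [wedgeTot_of, formEval_of, formEval_of, formEval_of, altWedgeTot_of]
  rfl

theorem formEval_insTot {k : ℕ} (K : VForm m M k) (x : M) (a : Forms m M) :
    formEval x (insTot K a) = altInsertTot (K.1 x) (formEval x a) := by
  induction a using Forms.induction with
  | h0 => simp
  | hadd a a' ha ha' => simp only [map_add, ha, ha']
  | hof q α =>
  cases q with
  | zero => rw [insTot_of_zero, formEval_of, altInsertTot_of_zero, map_zero]
  | succ q =>
    rw [insTot_of_succ, formEval_of, formEval_of, altInsertTot_of_succ]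
    rfl

/-- At x both α and dα are pullbacks, along the same linear map, of data in the chart at x. As
pullback respects wedge products, the Leibniz rule on the model space carries over. -/
theorem formEval_of_chart {k : ℕ} (x : M) (α : Form m M k) :
    formEval x α.toForms =
      altPull (chartD x x) (altOf k (chartRep α.1 x (extChartAt (𝓡 m) x x))) := by
  rw [formEval_of, altPull_of, chartRep_comp_chartD α.1 x x (mem_extChartAt_source x)]

theorem formEval_dTot_of {k : ℕ} (x : M) (α : Form m M k) :
    formEval x (dTot m M α.toForms) =
      altPull (chartD x x) (altOf (k + 1) (extDeriv (chartRep α.1 x) (extChartAt (𝓡 m) x x))) := by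
  rw [dTot_of, formEval_of, altPull_of]
  rfl

theorem Form.contDiffAt_chartRep {k : ℕ} (α : Form m M k) (x : M) :
    ContDiffAt ℝ ∞ (chartRep α.1 x) (extChartAt (𝓡 m) x x) :=
  (α.2 x).contDiffAt ((isOpen_target x).mem_nhds (mem_extChartAt_target x))

theorem Form.differentiableAt_chartRep {k : ℕ} (α : Form m M k) (x : M) :
    DifferentiableAt ℝ (chartRep α.1 x) (extChartAt (𝓡 m) x x) :=
  (α.contDiffAt_chartRep x).differentiableAt (by simp)

theorem wedgeTot_assoc (a b c : Forms m M) :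
    wedgeTot m M (wedgeTot m M a b) c = wedgeTot m M a (wedgeTot m M b c) :=
  Forms.ext_eval fun x => by simp only [formEval_wedgeTot, altWedgeTot_assoc]

theorem wedgeTot_comm {k l : ℕ} (α : Form m M k) (β : Form m M l) :
    wedgeTot m M α.toForms β.toForms =
      (-1 : ℝ) ^ (k * l) • wedgeTot m M β.toForms α.toForms :=
  Forms.ext_eval fun x => by
    rw [map_smul]
    simp only [formEval_wedgeTot, formEval_of]
    exact altWedgeTot_comm _ _

/-- Insertion of a tangent bundle valued form of degree `k` is a graded derivation of degree
`k - 1`. -/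
theorem insTot_wedgeTot {k p : ℕ} (K : VForm m M k) (α : Form m M p) (b : Forms m M) :
    insTot K (wedgeTot m M α.toForms b) = wedgeTot m M (insTot K α.toForms) b +
      (-1 : ℝ) ^ ((k + 1) * p) • wedgeTot m M α.toForms (insTot K b) :=
  Forms.ext_eval fun x => by
    simp only [map_add, map_smul, formEval_wedgeTot, formEval_insTot, formEval_of,
      altInsertTot_wedge]

theorem insTot_wedgeV {k l : ℕ} (φ : Form m M k) (K : VForm m M l) (a : Forms m M) :
    insTot (wedgeV k l φ K) a = wedgeTot m M φ.toForms (insTot K a) :=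
  Forms.ext_eval fun x => by
    simp only [formEval_wedgeTot, formEval_insTot, formEval_of]
    exact altInsertTot_altWedge _ _ _

theorem insTot_idForm {k : ℕ} (α : Form m M k) :
    insTot (idForm m M) α.toForms = (k : ℝ) • α.toForms :=
  Forms.ext_eval fun x => by
    simp only [map_smul, formEval_insTot, formEval_of]
    exact altInsertTot_id _

/-- The exterior derivative is a graded derivation of degree one. -/
theorem dTot_wedgeTot {k : ℕ} (α : Form m M k) (b : Forms m M) :
    dTot m M (wedgeTot m M α.toForms b) = wedgeTot m M (dTot m M α.toForms) b +
      (-1 : ℝ) ^ k • wedgeTot m M α.toForms (dTot m M b) := by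
  induction b using Forms.induction with
  | h0 => simp
  | hadd a a' ha ha' =>
    simp only [map_add, ha, ha', smul_add]
    abel
  | hof l β =>
  refine Forms.ext_eval fun x => ?_
  rw [wedgeTot_of, formEval_dTot_of, map_add, map_smul, formEval_wedgeTot, formEval_wedgeTot,
    formEval_dTot_of, formEval_dTot_of, formEval_of_chart, formEval_of_chart,
    ← altPull_wedge, ← altPull_wedge, ← map_smul, ← map_add,
    ← extDeriv_altWedge (α.differentiableAt_chartRep x) (β.differentiableAt_chartRep x)]
  congr 3
  funext y
  exact chartRep_rawWedge α.1 β.1 x y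

theorem dTot_dTot (a : Forms m M) : dTot m M (dTot m M a) = 0 := by
  induction a using Forms.induction with
  | h0 => simp
  | hadd a a' ha ha' => simp only [map_add, ha, ha', add_zero]
  | hof k α =>
  refine Forms.ext_eval fun x => ?_
  rw [dTot_of, formEval_dTot_of]
  -- At each point dα is defined through that point's own chart; independence of the chart allows
  -- the fixed chart at x to be used nearby, so that d² = 0 on the model space applies.
  have h : chartRep (extD k α).1 x =ᶠ[nhds (extChartAt (𝓡 m) x x)] extDeriv (chartRep α.1 x) := by
    filter_upwards [(isOpen_target x).mem_nhds (mem_extChartAt_target x)] with y hy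
    exact chartRep_rawExtD α.2 x hy
  rw [h.extDeriv_eq, extDeriv_extDeriv_apply (α.contDiffAt_chartRep x)
    (by simp only [minSmoothness_of_isRCLikeNormedField]; exact WithTop.coe_le_coe.2 le_top)]
  simp

end Evaluation

/-! ### Injectivity of φ ↦ φ ∧ I on a fibre -/

section Nondegeneracy

variable {V : Type*} [AddCommGroup V] [Module ℝ V] [TopologicalSpace V]
  [IsTopologicalAddGroup V] [ContinuousSMul ℝ V]

theorem altInsert_one_form {k : ℕ} (K : V [⋀^Fin k]→L[ℝ] V) (f : V →L[ℝ] ℝ) (v : Fin k → V) :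
    altInsert k 0 K (altCovector f) v = f (K v) := by
  rw [altInsert_apply]
  have h : ∀ σ : Equiv.Perm (Fin (k + 0)), Equiv.Perm.sign σ •
      (altCovector f) (Fin.cons (K fun i => v (σ (Fin.castAdd 0 i)))
        fun j => v (σ (Fin.natAdd k j))) = f (K v) := by
    intro σ
    have h : K (fun i => v (σ (Fin.castAdd 0 i))) = Equiv.Perm.sign σ • K v :=
      K.toAlternatingMap.map_perm v σ
    rw [h]
    rcases Int.units_eq_one_or (Equiv.Perm.sign σ) with h | h <;> simp [h]
  rw [Finset.sum_congr rfl fun σ _ => h σ]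
  have := Nat.factorial_ne_zero k
  simp [Fintype.card_perm]
  field_simp

variable [FiniteDimensional ℝ V] [T2Space V]

/-- Contracting e^j ∧ φ = 0 with e_j gives φ = e^j ∧ i_{e_j} φ. Summing over j and applying Euler's
identity gives n φ = k φ with n the dimension, and k < n. -/
theorem eq_zero_of_covector_wedge_eq_zero {k : ℕ} (hk : k < Module.finrank ℝ V)
    {φ : V [⋀^Fin k]→L[ℝ] ℝ}
    (h : ∀ f : V →L[ℝ] ℝ, altWedgeTot V (altOf 1 (altCovector f)) (altOf k φ) = 0) : φ = 0 := by
  let b := Module.finBasis ℝ V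
  have h1 : ∀ j, altWedgeTot V (altOf 1 (altCovector (coordL b j)))
      (altContractTot (b j) (altOf k φ)) = altOf k φ := by
    intro j
    have h2 := altContractTot_covector_wedge (b j) (coordL b j) (altOf k φ)
    rw [h, map_zero, coordL_apply, b.repr_self, Finsupp.single_eq_same, one_smul] at h2
    have h3 := congrArg
      (fun x => x + altWedgeTot V (altOf 1 (altCovector (coordL b j)))
        (altContractTot (b j) (altOf k φ))) h2
    simp only [zero_add] at h3
    rw [h3]
    module
  have h2 := sum_covector_wedge_contract b φ
  rw [Finset.sum_congr rfl fun j _ => h1 j, Finset.sum_const, Finset.card_univ,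
    Fintype.card_fin, ← Nat.cast_smul_eq_nsmul ℝ, ← map_smul, ← map_smul] at h2
  have h3 := congrArg (fun x => x k) h2
  simp only [DirectSum.lof_apply] at h3
  ext v
  have h4 : (Module.finrank ℝ V : ℝ) * φ v = k * φ v := congrArg (fun x => x v) h3
  have h5 : ((Module.finrank ℝ V : ℝ) - k) * φ v = 0 := by linarith
  have h6 : (k : ℝ) < Module.finrank ℝ V := by exact_mod_cast hk
  rcases mul_eq_zero.1 h5 with h | h
  · linarith
  · exact h

/-- Inserting φ ∧ I into a covector f gives φ ∧ f, so all these products vanish. -/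
theorem eq_zero_of_altWedge_id_eq_zero {k : ℕ} (hk : k < Module.finrank ℝ V)
    {φ : V [⋀^Fin k]→L[ℝ] ℝ}
    (h : altWedge k 1 φ (ContinuousAlternatingMap.ofSubsingleton ℝ V V (0 : Fin 1)
      (ContinuousLinearMap.id ℝ V)) = 0) : φ = 0 := by
  refine eq_zero_of_covector_wedge_eq_zero hk fun f => ?_
  have h1 := altInsertTot_altWedge φ (ContinuousAlternatingMap.ofSubsingleton ℝ V V (0 : Fin 1)
      (ContinuousLinearMap.id ℝ V)) (altOf 1 (altCovector f))
  rw [h, altInsertTot_id, altInsertTot_of_succ, map_zero, LinearMap.zero_apply, map_zero,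
    Nat.cast_one, one_smul] at h1
  rw [altWedgeTot_comm, ← h1, smul_zero]

end Nondegeneracy

/-! ### A vector valued form is determined by its Lie derivative -/

section Uniqueness

variable {m : ℕ} {M : Type*} [TopologicalSpace M] [ChartedSpace (EuclideanSpace ℝ (Fin m)) M]
  [IsManifold (𝓡 m) ∞ M]

theorem lieD_add {k : ℕ} (K L : VForm m M k) : lieD (K + L) = lieD K + lieD L := by
  have h : insTot (K + L) = insTot K + insTot L := by
    refine LinearMap.ext fun a => ?_
    induction a using Forms.induction with
    | h0 => simp
    | hadd a a' ha ha' => rw [map_add, ha, ha', map_add]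
    | hof q α =>
    cases q with
    | zero => simp only [LinearMap.add_apply, insTot_of_zero, add_zero]
    | succ q =>
      simp only [LinearMap.add_apply, insTot_of_succ, map_add]
  simp only [lieD, h, LinearMap.add_comp, LinearMap.comp_add, smul_add]
  abel

theorem lieD_smul {k : ℕ} (c : ℝ) (K : VForm m M k) : lieD (c • K) = c • lieD K := by
  have h : insTot (c • K) = c • insTot K := by
    refine LinearMap.ext fun a => ?_
    induction a using Forms.induction with
    | h0 => simp
    | hadd a a' ha ha' => rw [map_add, ha, ha', map_add]
    | hof q α =>
    cases q with
    | zero => simp only [LinearMap.smul_apply, insTot_of_zero, smul_zero]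
    | succ q =>
      simp only [LinearMap.smul_apply, insTot_of_succ, map_smul]
  simp only [lieD, h, LinearMap.smul_comp, LinearMap.comp_smul, smul_add, smul_smul]
  rw [mul_comm]

/-- A smooth function as a form of degree zero. -/
def Form.ofFun (g : M → ℝ) (hg : ContMDiff (𝓡 m) 𝓘(ℝ) ∞ g) : Form m M 0 :=
  ⟨fun x => ContinuousAlternatingMap.constOfIsEmpty ℝ (TangentSpace (𝓡 m) x) (Fin 0) (g x), by
    intro x₀
    have h : ContDiffOn ℝ ∞ (fun y => g ((extChartAt (𝓡 m) x₀).symm y))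
        (extChartAt (𝓡 m) x₀).target :=
      (hg.comp_contMDiffOn (contMDiffOn_extChartAt_symm x₀)).contDiffOn
    exact (ContinuousAlternatingMap.constOfIsEmptyLIE ℝ (Euc m) ℝ (Fin 0)).contDiff.comp_contDiffOn
      h⟩

theorem extD_ofFun_apply (g : M → ℝ) (hg : ContMDiff (𝓡 m) 𝓘(ℝ) ∞ g) (x : M) :
    (extD 0 (Form.ofFun g hg)).1 x =
      altCovector ((fderiv ℝ (fun y => g ((extChartAt (𝓡 m) x).symm y))
        (extChartAt (𝓡 m) x x)).comp (chartD x x)) := by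
  have h : chartRep (Form.ofFun g hg).1 x = fun y =>
      ContinuousAlternatingMap.constOfIsEmpty ℝ (Euc m) (Fin 0)
        (g ((extChartAt (𝓡 m) x).symm y)) := rfl
  change (extDeriv (chartRep (Form.ofFun g hg).1 x) _).compContinuousLinearMap _ = _
  rw [h, extDeriv_constOfIsEmpty]
  rfl

/-- The witness is the linear function f in the chart at x, cut off by a bump function equal to 1
near x. The Hausdorff condition makes its extension by zero smooth. -/
theorem exists_form_extD_eq [T2Space M] (x : M) (f : Euc m →L[ℝ] ℝ) :
    ∃ g : Form m M 0, (extD 0 g).1 x = altCovector (f.comp (chartD x x)) := by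
  obtain ⟨b⟩ : Nonempty (SmoothBumpFunction (𝓡 m) x) := inferInstance
  have hg : ContMDiff (𝓡 m) 𝓘(ℝ) ∞ fun p => b p • f (extChartAt (𝓡 m) x p) :=
    b.contMDiff_smul (f.contMDiff.comp_contMDiffOn contMDiffOn_extChartAt)
  refine ⟨Form.ofFun _ hg, ?_⟩
  rw [extD_ofFun_apply]
  congr 2
  have hc : ContinuousAt (extChartAt (𝓡 m) x).symm (extChartAt (𝓡 m) x x) :=
    continuousAt_extChartAt_symm x
  have h1 : ∀ᶠ y in nhds (extChartAt (𝓡 m) x x), b ((extChartAt (𝓡 m) x).symm y) = 1 := by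
    have := hc.eventually (p := fun p => b p = 1)
      (by rw [extChartAt_to_inv]; exact b.eventuallyEq_one)
    exact this
  have h2 : (fun y => b ((extChartAt (𝓡 m) x).symm y) •
      f (extChartAt (𝓡 m) x ((extChartAt (𝓡 m) x).symm y))) =ᶠ[nhds (extChartAt (𝓡 m) x x)] f := by
    filter_upwards [h1, (isOpen_target x).mem_nhds (mem_extChartAt_target x)] with y hy hy'
    rw [hy, one_smul, (extChartAt (𝓡 m) x).right_inv hy']
  rw [h2.fderiv_eq]
  exact f.hasFDerivAt.fderiv

theorem lieD_of_zero {k : ℕ} (K : VForm m M k) (g : Form m M 0) :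
    lieD K g.toForms = (insertion k 0 K (extD 0 g)).toForms := by
  simp only [lieD, LinearMap.add_apply, LinearMap.smul_apply, LinearMap.comp_apply,
    insTot_of_zero, map_zero, smul_zero, add_zero, dTot_of, insTot_of_succ]

/-- A tangent bundle valued form is determined by its Lie derivative. -/
theorem lieD_injective [T2Space M] {k : ℕ} : Function.Injective (lieD (m := m) (M := M) (k := k)) := by
  have key : ∀ N : VForm m M k, lieD N = 0 → N = 0 := by
    intro N hN
    refine Subtype.ext (funext fun x => ?_)
    ext1 v
    -- On functions Θ(N) g = i_N dg, and dg at x can be prescribed arbitrarily.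
    have h1 : ∀ f : Euc m →L[ℝ] ℝ, f (chartD x x (N.1 x v)) = 0 := by
      intro f
      obtain ⟨g, hg⟩ := exists_form_extD_eq x f
      have h2 := lieD_of_zero N g
      rw [hN, LinearMap.zero_apply] at h2
      have h4 : insertion k 0 N (extD 0 g) = 0 := by
        have h5 := Form.toForms_apply_self (insertion k 0 N (extD 0 g))
        rw [← h2] at h5
        exact h5.symm
      have h5 : altInsert k 0 (N.1 x) ((extD 0 g).1 x) = 0 :=
        congrFun (congrArg Subtype.val h4) x
      rw [hg] at h5
      have h6 := altInsert_one_form (N.1 x) (f.comp (chartD x x)) v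
      rw [h5] at h6
      exact h6.symm
    have h2 : chartD x x (N.1 x v) = 0 := by
      refine PiLp.ext fun i => ?_
      exact h1 (EuclideanSpace.proj i)
    obtain ⟨y, hy, hyx⟩ : ∃ y ∈ (extChartAt (𝓡 m) x).target, (extChartAt (𝓡 m) x).symm y = x :=
      ⟨_, mem_extChartAt_target x, extChartAt_to_inv x⟩
    have h3 : ∀ w : TangentSpace (𝓡 m) x, chartD x x w = 0 → w = 0 := by
      have h4 := chartSymmD_chartD x hy
      rw [hyx] at h4
      intro w hw
      have h5 := h4 w
      rw [hw] at h5
      rw [← h5]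
      exact map_zero _
    exact h3 _ h2
  intro K L h
  have h1 : lieD (K + (-1 : ℝ) • L) = 0 := by
    rw [lieD_add, lieD_smul, h]
    module
  have h2 := key _ h1
  have h3 : K - L = 0 := by
    rw [← h2]
    module
  exact sub_eq_zero.1 h3

theorem finrank_tangentSpace (x : M) : Module.finrank ℝ (TangentSpace (𝓡 m) x) = m :=
  finrank_euclideanSpace_fin (𝕜 := ℝ) (n := m)

theorem VForm.eq_zero_of_lt {k : ℕ} (hk : m < k) (K : VForm m M k) : K = 0 := by
  refine Subtype.ext (funext fun x => ?_)
  ext1 v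
  refine (K.1 x).toAlternatingMap.map_linearDependent v fun h => ?_
  have := h.fintype_card_le_finrank
  rw [finrank_tangentSpace, Fintype.card_fin] at this
  omega

theorem wedgeV_idForm_eq_zero {k : ℕ} (hk : k < m) {φ : Form m M k}
    (h : wedgeV k 1 φ (idForm m M) = 0) : φ = 0 := by
  refine Subtype.ext (funext fun x => ?_)
  refine eq_zero_of_altWedge_id_eq_zero (by rwa [finrank_tangentSpace]) ?_
  exact congrFun (congrArg Subtype.val h) x

end Uniqueness

/-! ### Calculus of Lie derivatives -/

section LieDerivative

variable {m : ℕ} {M : Type*} [TopologicalSpace M] [ChartedSpace (EuclideanSpace ℝ (Fin m)) M]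
  [IsManifold (𝓡 m) ∞ M]

theorem lieD_apply {k : ℕ} (K : VForm m M k) (a : Forms m M) :
    lieD K a = insTot K (dTot m M a) + (-1 : ℝ) ^ k • dTot m M (insTot K a) := rfl

theorem lieD_of_succ {k q : ℕ} (K : VForm m M k) (α : Form m M (q + 1)) :
    lieD K α.toForms = (insertion k (q + 1) K (extD (q + 1) α) +
      (-1 : ℝ) ^ k • extD (k + q) (insertion k q K α)).toForms := by
  rw [lieD_apply, dTot_of, insTot_of_succ, insTot_of_succ, dTot_of]
  exact (((DirectSum.lof ℝ ℕ (fun k => Form m M k) (k + (q + 1))).map_add _ _).trans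
    (congrArg _ (LinearMap.map_smul _ _ _))).symm

/-- Θ(K) has degree k. This supplies homogeneous forms to the product rules, whose first factor is
homogeneous. -/
theorem exists_lieD_eq {k q : ℕ} (K : VForm m M k) (α : Form m M q) :
    ∃ β : Form m M (k + q), lieD K α.toForms = β.toForms := by
  cases q with
  | zero => exact ⟨_, lieD_of_zero K α⟩
  | succ q => exact ⟨_, lieD_of_succ K α⟩

theorem dTot_lieD {k : ℕ} (K : VForm m M k) (a : Forms m M) :
    dTot m M (lieD K a) = dTot m M (insTot K (dTot m M a)) := by
  rw [lieD_apply, map_add, map_smul, dTot_dTot, smul_zero, add_zero]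

theorem lieD_dTot {k : ℕ} (K : VForm m M k) (a : Forms m M) :
    lieD K (dTot m M a) = (-1 : ℝ) ^ k • dTot m M (lieD K a) := by
  rw [dTot_lieD, lieD_apply, dTot_dTot, map_zero, zero_add]

/-- The form i_K α has degree k + p - 1, a parity written here as k + p + 1 to stay in the natural
numbers. For p = 0 it vanishes, so the sign is immaterial. -/
theorem dTot_insTot_wedgeTot {k p : ℕ} (K : VForm m M k) (α : Form m M p) (b : Forms m M) :
    dTot m M (wedgeTot m M (insTot K α.toForms) b) =
      wedgeTot m M (dTot m M (insTot K α.toForms)) b +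
        (-1 : ℝ) ^ (k + p + 1) • wedgeTot m M (insTot K α.toForms) (dTot m M b) := by
  cases p with
  | zero => simp [insTot_of_zero]
  | succ q =>
    rw [insTot_of_succ, dTot_wedgeTot,
      show (-1 : ℝ) ^ (k + (q + 1) + 1) = (-1) ^ (k + q) by ring]

/-- The Lie derivative along a tangent bundle valued form of degree `k` is a graded derivation
of degree `k`. -/
theorem lieD_wedgeTot {k p : ℕ} (K : VForm m M k) (α : Form m M p) (b : Forms m M) :
    lieD K (wedgeTot m M α.toForms b) = wedgeTot m M (lieD K α.toForms) b +
      (-1 : ℝ) ^ (k * p) • wedgeTot m M α.toForms (lieD K b) := by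
  simp only [lieD_apply]
  rw [dTot_wedgeTot, insTot_wedgeTot]
  simp only [map_add, map_smul]
  rw [insTot_wedgeTot, dTot_insTot_wedgeTot, dTot_wedgeTot]
  rw [show dTot m M α.toForms = (extD p α).toForms from dTot_of α, insTot_wedgeTot]
  simp only [LinearMap.add_apply, LinearMap.smul_apply]
  -- The mixed terms i_K α ∧ db and dα ∧ i_K b cancel; fixing the parities turns the signs into
  -- numbers.
  rcases Nat.even_or_odd k with hk | hk <;> rcases Nat.even_or_odd p with hp | hp <;>
  simp only [add_mul, mul_add, one_mul, mul_one, pow_add, pow_mul, pow_one, hk.neg_one_pow,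
    hp.neg_one_pow, one_pow] <;>
  module

/-- Insertion of φ ∧ I multiplies a q-form by q and wedges it with φ. The terms (q+1) φ ∧ dη and -q
φ ∧ dη, from the two halves of Θ, leave a single φ ∧ dη. -/
theorem lieD_wedgeV_idForm {p q : ℕ} (φ : Form m M p) (η : Form m M q) :
    lieD (wedgeV p 1 φ (idForm m M)) η.toForms =
      wedgeTot m M φ.toForms (dTot m M η.toForms) -
        ((-1 : ℝ) ^ p * q) • wedgeTot m M (dTot m M φ.toForms) η.toForms := by
  rw [lieD_apply, insTot_wedgeV, insTot_wedgeV, dTot_of η, insTot_idForm, insTot_idForm,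
    map_smul, map_smul, map_smul, dTot_wedgeTot, dTot_of η]
  rcases Nat.even_or_odd p with hp | hp <;>
  simp only [pow_add, pow_one, hp.neg_one_pow] <;> push_cast <;> module

/-- As dφ is closed of degree p + 1, d passes it with sign (-1)^(p+1), turning (-1)^(p+1+k) into the
sign (-1)^k of Θ(K). -/
theorem lieD_wedgeV_extD {p k : ℕ} (φ : Form m M p) (K : VForm m M k) (a : Forms m M) :
    lieD (wedgeV (p + 1) k (extD p φ) K) a = wedgeTot m M (dTot m M φ.toForms) (lieD K a) := by
  have h : dTot m M (extD p φ).toForms = 0 := by rw [← dTot_of, dTot_dTot]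
  simp only [lieD_apply]
  rw [insTot_wedgeV, insTot_wedgeV, dTot_wedgeTot, h, dTot_of, map_zero, LinearMap.zero_apply,
    zero_add, smul_smul, map_add, map_smul, ← pow_add]
  congr 2
  rw [show p + 1 + k + (p + 1) = 2 * (p + 1) + k by ring, pow_add, pow_mul]
  simp

theorem lieD_idForm {k : ℕ} (α : Form m M k) :
    lieD (idForm m M) α.toForms = dTot m M α.toForms := by
  rw [lieD_apply, insTot_idForm, dTot_of, insTot_idForm, map_smul, dTot_of]
  push_cast
  module

/-- The Lie derivative as a linear function of the tangent bundle valued form. -/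
def lieTot : VForms m M →ₗ[ℝ] Forms m M →ₗ[ℝ] Forms m M :=
  DirectSum.toModule ℝ ℕ _ fun _ =>
    { toFun := lieD, map_add' := lieD_add, map_smul' := lieD_smul }

theorem lieTot_of {k : ℕ} (K : VForm m M k) : lieTot K.toVForms = lieD K := by
  simp [lieTot]

variable (m M) in
/-- The homogeneous elements of degree `n` of `Ω(M; TM)`. -/
def vHom (n : ℕ) : Submodule ℝ (VForms m M) :=
  LinearMap.range (DirectSum.lof ℝ ℕ (fun k => VForm m M k) n)

theorem toVForms_mem_vHom {n n' : ℕ} (h : n = n') (K : VForm m M n) : K.toVForms ∈ vHom m M n' := by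
  subst h
  exact ⟨K, rfl⟩

theorem vHom_congr {n n' : ℕ} (h : n = n') : vHom m M n = vHom m M n' := by rw [h]

/-- The graded commutator of Lie derivatives. -/
def lieComm {k l : ℕ} (K : VForm m M k) (L : VForm m M l) : Forms m M →ₗ[ℝ] Forms m M :=
  (lieD K).comp (lieD L) - ((-1 : ℝ) ^ (k * l)) • (lieD L).comp (lieD K)

theorem lieComm_swap {k l : ℕ} (K : VForm m M k) (L : VForm m M l) :
    lieComm L K = (-(-1 : ℝ) ^ (k * l)) • lieComm K L := by
  simp only [lieComm, mul_comm l k]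
  rcases Nat.even_or_odd (k * l) with h | h <;> simp only [h.neg_one_pow] <;> module

/-! ### Brackets with forms φ ∧ I -/

section Bracket

variable [T2Space M]

theorem lieTot_injOn {n : ℕ} {X Y : VForms m M} (hX : X ∈ vHom m M n) (hY : Y ∈ vHom m M n)
    (h : lieTot X = lieTot Y) : X = Y := by
  obtain ⟨K, rfl⟩ := hX
  obtain ⟨L, rfl⟩ := hY
  rw [lieTot_of, lieTot_of] at h
  rw [lieD_injective h]

/-- The bracket is defined by choice. One candidate with the right degree and Lie derivative shows
that the choice has its defining property, and injectivity of Θ identifies it with the candidate. -/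
theorem fnBracket_eq_of_lieTot {k l : ℕ} {K : VForm m M k} {L : VForm m M l} {X : VForms m M}
    (hX : X ∈ vHom m M (k + l)) (h : lieTot X = lieComm K L) :
    IsFNBracket K L (fnBracket K L) ∧ (fnBracket K L).toVForms = X := by
  have hs : IsFNBracket K L (fnBracket K L) := by
    obtain ⟨N, rfl⟩ := hX
    rw [lieTot_of] at h
    exact Classical.epsilon_spec (p := IsFNBracket K L) ⟨N, h⟩
  refine ⟨hs, lieTot_injOn (toVForms_mem_vHom rfl _) hX ?_⟩
  rw [lieTot_of, h]
  exact hs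

theorem fnBracket_zero_right {k : ℕ} (l : ℕ) (K : VForm m M k) :
    (fnBracket K (0 : VForm m M l)).toVForms = 0 := by
  have h0 : lieD (0 : VForm m M l) = 0 := by simpa using lieD_smul (0 : ℝ) (0 : VForm m M l)
  refine (fnBracket_eq_of_lieTot (Submodule.zero_mem _) ?_).2
  simp [lieComm, h0]

theorem fnBracket_zero_left {l : ℕ} (k : ℕ) (L : VForm m M l) :
    (fnBracket (0 : VForm m M k) L).toVForms = 0 := by
  have h0 : lieD (0 : VForm m M k) = 0 := by simpa using lieD_smul (0 : ℝ) (0 : VForm m M k)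
  refine (fnBracket_eq_of_lieTot (Submodule.zero_mem _) ?_).2
  simp [lieComm, h0]

theorem wedgeI_lieD_mem_vHom {k p : ℕ} (K : VForm m M k) (φ : Form m M p) :
    wedgeI m M (lieD K φ.toForms) ∈ vHom m M (k + (p + 1)) := by
  obtain ⟨ψ, hψ⟩ := exists_lieD_eq K φ
  rw [hψ, wedgeI_of]
  exact toVForms_mem_vHom rfl _

/-- Apply both sides to a q-form η. The coefficient q in Θ(φ∧I) η becomes q + k on Θ(K) η; the
excess is k dφ ∧ Θ(K) η, which is k Θ(dφ∧K) η. The terms in which Θ(K) falls on φ or dφ assemble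
into Θ(Θ(K)φ ∧ I) η, and the others cancel. -/
theorem lieTot_wedgeI_lieD_add {k p : ℕ} (K : VForm m M k) (φ : Form m M p) :
    lieTot (wedgeI m M (lieD K φ.toForms) +
      ((-1 : ℝ) ^ (k * (p + 1) + p) * k) • (wedgeV (p + 1) k (extD p φ) K).toVForms) =
      lieComm K (wedgeV p 1 φ (idForm m M)) := by
  refine LinearMap.ext fun a => ?_
  induction a using Forms.induction with
  | h0 => simp
  | hadd a b ha hb => rw [map_add, ha, hb, map_add]
  | hof q η =>
  obtain ⟨ψ, hψ⟩ := exists_lieD_eq K φ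
  obtain ⟨χ, hχ⟩ := exists_lieD_eq K η
  simp only [lieComm, LinearMap.sub_apply, LinearMap.smul_apply, LinearMap.comp_apply]
  rw [lieD_wedgeV_idForm φ η, map_sub, map_smul, lieD_wedgeTot, lieD_dTot, hχ,
    lieD_wedgeV_idForm φ χ, dTot_of φ, lieD_wedgeTot, ← dTot_of φ, lieD_dTot, hψ, hχ, wedgeI_of,
    map_add, map_smul, lieTot_of, lieTot_of, LinearMap.add_apply, LinearMap.smul_apply,
    lieD_wedgeV_idForm ψ η, lieD_wedgeV_extD, hχ]
  simp only [map_smul, LinearMap.smul_apply]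
  rcases Nat.even_or_odd k with hk | hk <;> rcases Nat.even_or_odd p with hp | hp <;>
  simp only [mul_add, one_mul, mul_one, pow_add, pow_mul, hk.neg_one_pow,
    hp.neg_one_pow, one_pow] <;> push_cast <;>
  module

/-- The Frölicher–Nijenhuis bracket `[K, φ ∧ I]`. -/
theorem fnBracket_wedgeV_idForm {k p : ℕ} (K : VForm m M k) (φ : Form m M p) :
    IsFNBracket K (wedgeV p 1 φ (idForm m M)) (fnBracket K (wedgeV p 1 φ (idForm m M))) ∧
    (fnBracket K (wedgeV p 1 φ (idForm m M))).toVForms = wedgeI m M (lieD K φ.toForms) +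
      ((-1 : ℝ) ^ (k * (p + 1) + p) * k) • (wedgeV (p + 1) k (extD p φ) K).toVForms :=
  fnBracket_eq_of_lieTot
    (Submodule.add_mem _ (wedgeI_lieD_mem_vHom K φ)
      (Submodule.smul_mem _ _ (toVForms_mem_vHom (by ring) _)))
    (lieTot_wedgeI_lieD_add K φ)

/-- The Frölicher–Nijenhuis bracket `[φ ∧ I, K]`. -/
theorem fnBracket_wedgeV_idForm_left {k p : ℕ} (K : VForm m M k) (φ : Form m M p) :
    (fnBracket (wedgeV p 1 φ (idForm m M)) K).toVForms = (-(-1 : ℝ) ^ (k * (p + 1))) •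
      (wedgeI m M (lieD K φ.toForms) +
      ((-1 : ℝ) ^ (k * (p + 1) + p) * k) • (wedgeV (p + 1) k (extD p φ) K).toVForms) := by
  refine (fnBracket_eq_of_lieTot (Submodule.smul_mem _ _ ?_) ?_).2
  · exact (vHom_congr (add_comm k (p + 1))).le (Submodule.add_mem _ (wedgeI_lieD_mem_vHom K φ)
      (Submodule.smul_mem _ _ (toVForms_mem_vHom (by ring) _)))
  · rw [map_smul, lieTot_wedgeI_lieD_add, lieComm_swap K]

variable (m M) in
/-- The bilinear operation on forms that induces the bracket of the forms `φ ∧ I`. -/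
def formBracket : Forms m M →ₗ[ℝ] Forms m M →ₗ[ℝ] Forms m M :=
  DirectSum.toModule ℝ ℕ _ fun k => LinearMap.flip <| DirectSum.toModule ℝ ℕ _ fun l =>
    (((-1 : ℝ) ^ (k + 1) * l) •
        (((wedge (k + 1) l).comp (extD k)).compr₂
          (DirectSum.lof ℝ ℕ (fun k => Form m M k) (k + 1 + l))) -
      ((-1 : ℝ) ^ (k * (l + 1)) * k) •
        ((((wedge (l + 1) k).comp (extD l)).flip).compr₂
          (DirectSum.lof ℝ ℕ (fun k => Form m M k) (l + 1 + k)))).flip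

theorem formBracket_of {k l : ℕ} (α : Form m M k) (β : Form m M l) :
    formBracket m M α.toForms β.toForms =
      ((-1 : ℝ) ^ (k + 1) * l) • wedgeTot m M (dTot m M α.toForms) β.toForms -
        ((-1 : ℝ) ^ (k * (l + 1)) * k) • wedgeTot m M (dTot m M β.toForms) α.toForms := by
  rw [dTot_of, dTot_of, wedgeTot_of, wedgeTot_of]
  simp [formBracket]

theorem fnBracket_wedgeI_wedgeI {k l : ℕ} (α : Form m M k) (β : Form m M l) :
    (fnBracket (wedgeV k 1 α (idForm m M)) (wedgeV l 1 β (idForm m M))).toVForms =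
      wedgeI m M (formBracket m M α.toForms β.toForms) := by
  have h : (wedgeV (l + 1) (k + 1) (extD l β) (wedgeV k 1 α (idForm m M))).toVForms =
      wedgeI m M (wedgeTot m M (dTot m M β.toForms) α.toForms) := by
    rw [dTot_of, wedgeTot_of, wedgeI_of]
    refine lieTot_injOn (n := l + 1 + (k + 1)) (toVForms_mem_vHom rfl _)
      (toVForms_mem_vHom (add_assoc _ _ _) _) ?_
    rw [lieTot_of, lieTot_of]
    -- Associativity dβ ∧ (α ∧ I) = (dβ ∧ α) ∧ I is checked on insertion operators, where it becomes
    -- associativity for scalar forms.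
    have h1 : insTot (wedgeV (l + 1) (k + 1) (extD l β) (wedgeV k 1 α (idForm m M))) =
        insTot (wedgeV (l + 1 + k) 1 (wedge (l + 1) k (extD l β) α) (idForm m M)) := by
      refine LinearMap.ext fun a => ?_
      rw [insTot_wedgeV, insTot_wedgeV, insTot_wedgeV, ← wedgeTot_of, wedgeTot_assoc]
    simp only [lieD, h1]
    congr 2
  rw [(fnBracket_wedgeV_idForm _ β).2, h, lieD_wedgeV_idForm, formBracket_of,
    ← map_smul (wedgeI m M), ← map_add]
  congr 1
  -- After moving dβ to the front, its term has coefficient 1 from Θ(α∧I) β and -(k+1) from the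
  -- correction, as α∧I has degree k + 1; up to the common sign this is -k.
  rw [dTot_of β, wedgeTot_comm α (extD l β), dTot_of α]
  rcases Nat.even_or_odd k with hk | hk <;> rcases Nat.even_or_odd l with hp | hp <;>
  simp only [add_mul, mul_add, one_mul, mul_one, pow_add, pow_mul, pow_one, hk.neg_one_pow,
    hp.neg_one_pow, one_pow] <;> push_cast <;>
  module

end Bracket

end LieDerivative

/-! ### Forms below the top degree -/

section LowForms

variable {m : ℕ} {M : Type*} [TopologicalSpace M] [ChartedSpace (EuclideanSpace ℝ (Fin m)) M]
  [IsManifold (𝓡 m) ∞ M]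

theorem LowForms.induction {P : LowForms m M → Prop} (u : LowForms m M) (h0 : P 0)
    (hof : ∀ (k : Fin m) (α : Form m M (k : ℕ)), P (Form.toLow α))
    (hadd : ∀ u v, P u → P v → P (u + v)) : P u :=
  DirectSum.induction_on u h0 hof hadd

theorem Form.toLow_apply_self {k : Fin m} (α : Form m M (k : ℕ)) : α.toLow k = α :=
  DirectSum.lof_apply ..

theorem Form.toLow_apply_ne {k l : Fin m} (α : Form m M (k : ℕ)) (h : k ≠ l) : α.toLow l = 0 :=
  DirectSum.of_eq_of_ne _ _ _ h.symm

theorem lowIncl_of {k : Fin m} (α : Form m M (k : ℕ)) : lowIncl m M α.toLow = α.toForms := by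
  simp [lowIncl]

theorem lowIncl_apply (u : LowForms m M) (k : Fin m) : lowIncl m M u (k : ℕ) = u k := by
  induction u using LowForms.induction with
  | h0 => simp
  | hadd u v hu hv => rw [map_add, DirectSum.add_apply, hu, hv, DirectSum.add_apply]
  | hof l α =>
    rw [lowIncl_of]
    by_cases h : l = k
    · subst h
      rw [Form.toForms_apply_self, Form.toLow_apply_self]
    · rw [Form.toForms_apply_ne _ (fun e => h (Fin.ext e)), Form.toLow_apply_ne _ h]

theorem lowIncl_apply_of_le (u : LowForms m M) {n : ℕ} (hn : m ≤ n) : lowIncl m M u n = 0 := by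
  induction u using LowForms.induction with
  | h0 => simp
  | hadd u v hu hv => rw [map_add, DirectSum.add_apply, hu, hv, add_zero]
  | hof l α =>
    rw [lowIncl_of, Form.toForms_apply_ne _ (by omega)]

theorem dropTop_of {k : Fin m} (α : Form m M (k : ℕ)) : dropTop m M α.toForms = α.toLow := by
  simp [dropTop]

theorem dropTop_of_le {k : ℕ} (hk : m ≤ k) (α : Form m M k) : dropTop m M α.toForms = 0 := by
  simp [dropTop, Nat.not_lt.2 hk]

theorem dropTop_apply (a : Forms m M) (k : Fin m) : dropTop m M a k = a (k : ℕ) := by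
  induction a using Forms.induction with
  | h0 => simp
  | hadd u v hu hv => rw [map_add, DirectSum.add_apply, hu, hv, DirectSum.add_apply]
  | hof l α =>
    rcases lt_or_ge l m with hl | hl
    · have h1 := dropTop_of (k := ⟨l, hl⟩) α
      rw [h1]
      by_cases h : (⟨l, hl⟩ : Fin m) = k
      · subst h
        rw [Form.toLow_apply_self, Form.toForms_apply_self]
      · rw [Form.toLow_apply_ne _ h, Form.toForms_apply_ne _ (fun e => h (Fin.ext e))]
    · rw [dropTop_of_le hl, Form.toForms_apply_ne _ (by omega), DirectSum.zero_apply]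

theorem VForm.toVForms_apply_self {k : ℕ} (K : VForm m M k) : K.toVForms k = K :=
  DirectSum.lof_apply ..

theorem VForm.toVForms_apply_ne {k l : ℕ} (K : VForm m M k) (h : k ≠ l) : K.toVForms l = 0 :=
  DirectSum.of_eq_of_ne _ _ _ h.symm

theorem Form.toForms_zero (k : ℕ) : (0 : Form m M k).toForms = 0 := map_zero _

theorem VForm.toVForms_zero (k : ℕ) : (0 : VForm m M k).toVForms = 0 := map_zero _

theorem wedgeI_apply_zero (a : Forms m M) : wedgeI m M a 0 = 0 := by
  induction a using Forms.induction with
  | h0 => simp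
  | hadd a b ha hb => rw [map_add, DirectSum.add_apply, ha, hb, add_zero]
  | hof k α => rw [wedgeI_of, VForm.toVForms_apply_ne _ (by omega)]

theorem wedgeI_apply_succ (a : Forms m M) (k : ℕ) :
    wedgeI m M a (k + 1) = wedgeV k 1 (a k) (idForm m M) := by
  induction a using Forms.induction with
  | h0 => simp
  | hadd a b ha hb =>
    rw [map_add, DirectSum.add_apply, ha, hb, DirectSum.add_apply, map_add, LinearMap.add_apply]
  | hof l α =>
    rw [wedgeI_of]
    by_cases h : l = k
    · subst h
      rw [VForm.toVForms_apply_self, Form.toForms_apply_self]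
    · rw [VForm.toVForms_apply_ne _ (by omega), Form.toForms_apply_ne _ h, map_zero,
        LinearMap.zero_apply]

theorem lowWedgeI_apply (u : LowForms m M) : lowWedgeI m M u = wedgeI m M (lowIncl m M u) := rfl

theorem lowWedgeI_of {k : Fin m} (α : Form m M (k : ℕ)) :
    lowWedgeI m M α.toLow = (wedgeV (k : ℕ) 1 α (idForm m M)).toVForms := by
  rw [lowWedgeI_apply, lowIncl_of, wedgeI_of]

/-- The dropped components have degree at least m, so their wedge with I has degree above m and is
zero. -/
theorem lowWedgeI_dropTop (a : Forms m M) : lowWedgeI m M (dropTop m M a) = wedgeI m M a := by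
  refine DFinsupp.ext fun n => ?_
  rw [lowWedgeI_apply]
  cases n with
  | zero => exact (wedgeI_apply_zero _).trans (wedgeI_apply_zero _).symm
  | succ n =>
    refine (wedgeI_apply_succ _ _).trans (Eq.trans ?_ (wedgeI_apply_succ _ _).symm)
    rcases lt_or_ge n m with hn | hn
    · have h := lowIncl_apply (dropTop m M a) ⟨n, hn⟩
      rw [dropTop_apply] at h
      rw [h]
    · rw [VForm.eq_zero_of_lt (by omega) (wedgeV n 1 (lowIncl m M (dropTop m M a) n) _),
        VForm.eq_zero_of_lt (by omega) (wedgeV n 1 (a n) _)]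

theorem lowWedgeI_injective : Function.Injective (lowWedgeI m M) := by
  rw [← LinearMap.ker_eq_bot, LinearMap.ker_eq_bot']
  intro u hu
  refine DFinsupp.ext fun k => ?_
  refine wedgeV_idForm_eq_zero k.2 ?_
  have h := wedgeI_apply_succ (lowIncl m M u) (k : ℕ)
  rw [← lowWedgeI_apply, hu, lowIncl_apply] at h
  exact h.symm

theorem sum_toForms_lowIncl (u : LowForms m M) :
    lowIncl m M u = ∑ p ∈ Finset.range m, (lowIncl m M u p).toForms := by
  refine DFinsupp.ext fun n => ?_
  have h : (∑ p ∈ Finset.range m, (lowIncl m M u p).toForms) n =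
      ∑ p ∈ Finset.range m, (lowIncl m M u p).toForms n :=
    DFinsupp.finsetSum_apply _ _ _
  refine Eq.trans ?_ h.symm
  rcases lt_or_ge n m with hn | hn
  · rw [Finset.sum_eq_single n, Form.toForms_apply_self]
    · intro p _ hp
      rw [Form.toForms_apply_ne _ hp]
    · intro h
      exact absurd (Finset.mem_range.2 hn) h
  · rw [Finset.sum_eq_zero, lowIncl_apply_of_le u hn]
    intro p hp
    rw [Form.toForms_apply_ne]
    have := Finset.mem_range.1 hp
    omega

/-- A subspace of `Ω(M)` that contains the homogeneous components of its elements. -/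
def IsGradedFormSubspace (P : Submodule ℝ (Forms m M)) : Prop :=
  ∀ a ∈ P, ∀ n : ℕ, (a n).toForms ∈ P

/-- The wedge with I cannot see components of degree at least m, and a graded P contains the
truncation of each of its elements. Hence ideals may be studied in Ω(M) without the degree bound. -/
theorem map_lowWedgeI_comap {P : Submodule ℝ (Forms m M)} (hP : IsGradedFormSubspace P) :
    (P.comap (lowIncl m M)).map (lowWedgeI m M) = P.map (wedgeI m M) := by
  apply le_antisymm
  · rintro _ ⟨u, hu, rfl⟩
    exact ⟨lowIncl m M u, hu, rfl⟩
  · rintro _ ⟨a, ha, rfl⟩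
    refine ⟨dropTop m M a, ?_, lowWedgeI_dropTop a⟩
    change lowIncl m M (dropTop m M a) ∈ P
    rw [sum_toForms_lowIncl]
    refine Submodule.sum_mem _ fun p hp => ?_
    have h := lowIncl_apply (dropTop m M a) ⟨p, Finset.mem_range.1 hp⟩
    rw [dropTop_apply] at h
    rw [h]
    exact hP a ha p

theorem isGradedSubspace_map_wedgeI {P : Submodule ℝ (Forms m M)} (hP : IsGradedFormSubspace P) :
    IsGradedSubspace (P.map (wedgeI m M)) := by
  rintro _ ⟨a, ha, rfl⟩ n
  cases n with
  | zero =>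
    rw [wedgeI_apply_zero, VForm.toVForms_zero]
    exact Submodule.zero_mem _
  | succ n =>
    rw [wedgeI_apply_succ, ← wedgeI_of]
    exact ⟨_, hP a ha n, rfl⟩

theorem dTot_apply_zero (a : Forms m M) : dTot m M a 0 = 0 := by
  induction a using Forms.induction with
  | h0 => simp
  | hadd a b ha hb => rw [map_add, DirectSum.add_apply, ha, hb, add_zero]
  | hof k α => rw [dTot_of, Form.toForms_apply_ne _ (by omega)]

theorem dTot_apply_succ (a : Forms m M) (k : ℕ) : dTot m M a (k + 1) = extD k (a k) := by
  induction a using Forms.induction with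
  | h0 => simp
  | hadd a b ha hb => rw [map_add, DirectSum.add_apply, ha, hb, DirectSum.add_apply, map_add]
  | hof l α =>
    rw [dTot_of]
    by_cases h : l = k
    · subst h
      rw [Form.toForms_apply_self, Form.toForms_apply_self]
    · rw [Form.toForms_apply_ne _ (by omega), Form.toForms_apply_ne _ h, map_zero]

theorem isGradedFormSubspace_range : IsGradedFormSubspace (LinearMap.range (dTot m M)) := by
  rintro _ ⟨a, rfl⟩ n
  cases n with
  | zero =>
    rw [dTot_apply_zero, Form.toForms_zero]
    exact Submodule.zero_mem _
  | succ n =>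
    rw [dTot_apply_succ, ← dTot_of]
    exact ⟨_, rfl⟩

theorem isGradedFormSubspace_ker : IsGradedFormSubspace (LinearMap.ker (dTot m M)) := by
  intro a ha n
  rw [LinearMap.mem_ker] at ha ⊢
  rw [dTot_of, ← dTot_apply_succ, ha, DirectSum.zero_apply, Form.toForms_zero]

theorem isGradedFormSubspace_top : IsGradedFormSubspace (⊤ : Submodule ℝ (Forms m M)) :=
  fun _ _ _ => Submodule.mem_top

/-! ### The ideals and the subalgebra -/

variable [T2Space M]

/-- A graded space of closed forms that contains the exact forms gives an abelian ideal. -/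
theorem isAbelianIdeal_map_wedgeI {P : Submodule ℝ (Forms m M)} (hP : IsGradedFormSubspace P)
    (hle : P ≤ LinearMap.ker (dTot m M)) (hge : LinearMap.range (dTot m M) ≤ P) :
    IsAbelianIdeal (P.map (wedgeI m M)) := by
  have hd : ∀ a ∈ P, ∀ p, extD p (a p) = 0 := by
    intro a ha p
    rw [← dTot_apply_succ, LinearMap.mem_ker.1 (hle ha), DirectSum.zero_apply]
  -- On a closed form only the half ± d i_K of Θ(K) survives, and P contains the exact forms.
  have hlie : ∀ {k : ℕ} (K : VForm m M k), ∀ a ∈ P, ∀ p, lieD K (a p).toForms ∈ P := by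
    intro k K a ha p
    rw [lieD_apply, dTot_of, hd a ha p, Form.toForms_zero, map_zero, zero_add]
    exact Submodule.smul_mem _ _ (hge ⟨_, rfl⟩)
  refine ⟨isGradedSubspace_map_wedgeI hP, ?_, ?_⟩
  · rintro K _ ⟨a, ha, rfl⟩
    constructor
    · refine Submodule.sum_mem _ fun k _ => Submodule.sum_mem _ fun l _ => ?_
      cases l with
      | zero =>
        rw [wedgeI_apply_zero, fnBracket_zero_right]
        exact Submodule.zero_mem _
      | succ p =>
        rw [wedgeI_apply_succ, (fnBracket_wedgeV_idForm _ _).2, hd a ha p, map_zero,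
          LinearMap.zero_apply, VForm.toVForms_zero, smul_zero, add_zero]
        exact ⟨_, hlie _ a ha p, rfl⟩
    · refine Submodule.sum_mem _ fun l _ => Submodule.sum_mem _ fun k _ => ?_
      cases l with
      | zero =>
        rw [wedgeI_apply_zero, fnBracket_zero_left]
        exact Submodule.zero_mem _
      | succ p =>
        rw [wedgeI_apply_succ, fnBracket_wedgeV_idForm_left, hd a ha p, map_zero,
          LinearMap.zero_apply, VForm.toVForms_zero, smul_zero, add_zero]
        exact Submodule.smul_mem _ _ ⟨_, hlie _ a ha p, rfl⟩
  · rintro _ ⟨a, ha, rfl⟩ _ ⟨b, hb, rfl⟩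
    refine Finset.sum_eq_zero fun k _ => Finset.sum_eq_zero fun l _ => ?_
    cases k with
    | zero => rw [wedgeI_apply_zero, fnBracket_zero_left]
    | succ p =>
    cases l with
    | zero => rw [wedgeI_apply_zero, fnBracket_zero_right]
    | succ q =>
      rw [wedgeI_apply_succ, wedgeI_apply_succ, fnBracket_wedgeI_wedgeI, formBracket_of, dTot_of,
        dTot_of, hd a ha p, hd b hb q]
      simp

/-- Wedging with I raises degrees by one, so degree 0 contributes nothing and the degrees 1, …, m of
the sum correspond to forms of degree below m. -/
theorem fnTot_wedgeI_wedgeI (a b : Forms m M) :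
    fnTot (wedgeI m M a) (wedgeI m M b) = wedgeI m M (∑ p ∈ Finset.range m,
      ∑ q ∈ Finset.range m, formBracket m M (a p).toForms (b q).toForms) := by
  simp only [fnTot, Finset.sum_range_succ', map_sum]
  simp only [wedgeI_apply_zero, fnBracket_zero_left, fnBracket_zero_right, add_zero,
    Finset.sum_const_zero, wedgeI_apply_succ, fnBracket_wedgeI_wedgeI]

theorem isGradedLieSubalgebra_range :
    IsGradedLieSubalgebra (LinearMap.range (lowWedgeI m M)) := by
  have h : LinearMap.range (lowWedgeI m M) = (⊤ : Submodule ℝ (Forms m M)).map (wedgeI m M) := by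
    rw [← map_lowWedgeI_comap isGradedFormSubspace_top, Submodule.comap_top, Submodule.map_top]
  rw [h]
  refine ⟨isGradedSubspace_map_wedgeI isGradedFormSubspace_top, ?_⟩
  rintro _ ⟨a, -, rfl⟩ _ ⟨b, -, rfl⟩
  rw [fnTot_wedgeI_wedgeI]
  exact ⟨_, Submodule.mem_top, rfl⟩

/-! ### The induced graded Lie algebra -/

variable (m M) in
/-- The bracket on `Ω^{*-1}(M)` induced by the Frölicher–Nijenhuis bracket. -/
def lowBracket : LowForms m M →ₗ[ℝ] LowForms m M →ₗ[ℝ] LowForms m M :=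
  ((formBracket m M).compl₁₂ (lowIncl m M) (lowIncl m M)).compr₂ (dropTop m M)

theorem lowBracket_apply (u v : LowForms m M) : lowBracket m M u v =
    dropTop m M (formBracket m M (lowIncl m M u) (lowIncl m M v)) := rfl

theorem lowWedgeI_lowBracket (u v : LowForms m M) :
    lowWedgeI m M (lowBracket m M u v) = fnTot (lowWedgeI m M u) (lowWedgeI m M v) := by
  rw [lowBracket_apply, lowWedgeI_dropTop, lowWedgeI_apply, lowWedgeI_apply, fnTot_wedgeI_wedgeI]
  congr 1
  conv_lhs => rw [sum_toForms_lowIncl u, sum_toForms_lowIncl v]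
  simp only [map_sum, LinearMap.sum_apply]
  exact Finset.sum_comm

theorem toLow_mem_lowGrading {k : Fin m} (α : Form m M (k : ℕ)) {n : ℕ} (h : (k : ℕ) + 1 = n) :
    α.toLow ∈ lowGrading m M n := by
  intro l hl
  refine Form.toLow_apply_ne _ ?_
  rintro rfl
  exact hl h

/-- Degrees 0 and above m are included: there the homogeneous part is zero. -/
theorem lowGrading_cases {n : ℕ} {x : LowForms m M} (hx : x ∈ lowGrading m M n) :
    x = 0 ∨ ∃ k : Fin m, (k : ℕ) + 1 = n ∧ ∃ α : Form m M (k : ℕ), x = α.toLow := by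
  by_cases h : ∃ k : Fin m, (k : ℕ) + 1 = n
  · obtain ⟨k, hk⟩ := h
    refine Or.inr ⟨k, hk, x k, DFinsupp.ext fun l => ?_⟩
    by_cases hl : k = l
    · subst hl
      exact (Form.toLow_apply_self _).symm
    · refine (hx l ?_).trans (Form.toLow_apply_ne _ hl).symm
      intro e
      exact hl (Fin.ext (by omega))
  · push Not at h
    exact Or.inl (DFinsupp.ext fun l => hx l (h l))

theorem dropTop_mem_lowGrading {n : ℕ} (γ : Form m M n) :
    dropTop m M γ.toForms ∈ lowGrading m M (n + 1) := by
  intro k hk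
  rw [dropTop_apply, Form.toForms_apply_ne]
  omega

theorem lowBracket_of {k l : Fin m} (α : Form m M (k : ℕ)) (β : Form m M (l : ℕ)) :
    lowBracket m M α.toLow β.toLow =
      dropTop m M (formBracket m M α.toForms β.toForms) := by
  rw [lowBracket_apply, lowIncl_of, lowIncl_of]

theorem lowBracket_mem {i j : ℕ} {x y : LowForms m M} (hx : x ∈ lowGrading m M i)
    (hy : y ∈ lowGrading m M j) : lowBracket m M x y ∈ lowGrading m M (i + j) := by
  rcases lowGrading_cases hx with rfl | ⟨k, rfl, α, rfl⟩
  · rw [map_zero, LinearMap.zero_apply]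
    exact Submodule.zero_mem _
  rcases lowGrading_cases hy with rfl | ⟨l, rfl, β, rfl⟩
  · rw [map_zero]
    exact Submodule.zero_mem _
  rw [lowBracket_of, formBracket_of, dTot_of, dTot_of, wedgeTot_of, wedgeTot_of, map_sub, map_smul,
    map_smul]
  have h1 := dropTop_mem_lowGrading (wedge (k + 1 : ℕ) l (extD k α) β)
  have h2 := dropTop_mem_lowGrading (wedge (l + 1 : ℕ) k (extD l β) α)
  rw [show (k : ℕ) + 1 + l + 1 = k + 1 + (l + 1) by ring] at h1
  rw [show (l : ℕ) + 1 + k + 1 = k + 1 + (l + 1) by ring] at h2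
  exact Submodule.sub_mem _ (Submodule.smul_mem _ _ h1) (Submodule.smul_mem _ _ h2)

variable (m M) in
/-- The Lie derivative along `u ∧ I`, as a linear function of `u`. -/
def lowLie : LowForms m M →ₗ[ℝ] Forms m M →ₗ[ℝ] Forms m M := lieTot.comp (lowWedgeI m M)

/-- Faithfulness in each degree: an identity between homogeneous low forms of equal degree may be
checked on their operators on Ω(M). -/
theorem lowLie_injOn {n : ℕ} {x y : LowForms m M} (hx : x ∈ lowGrading m M n)
    (hy : y ∈ lowGrading m M n) (h : lowLie m M x = lowLie m M y) : x = y := by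
  have hhom : ∀ z ∈ lowGrading m M n, lowWedgeI m M z ∈ vHom m M n := by
    intro z hz
    rcases lowGrading_cases hz with rfl | ⟨k, hk, α, rfl⟩
    · rw [map_zero]
      exact Submodule.zero_mem _
    · rw [lowWedgeI_of]
      exact toVForms_mem_vHom hk _
  exact lowWedgeI_injective (lieTot_injOn (hhom x hx) (hhom y hy) h)

theorem lowLie_lowBracket {i j : ℕ} {x y : LowForms m M} (hx : x ∈ lowGrading m M i)
    (hy : y ∈ lowGrading m M j) : lowLie m M (lowBracket m M x y) =
      (lowLie m M x).comp (lowLie m M y) -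
        (-1 : ℝ) ^ (i * j) • (lowLie m M y).comp (lowLie m M x) := by
  rcases lowGrading_cases hx with rfl | ⟨k, rfl, α, rfl⟩
  · simp
  rcases lowGrading_cases hy with rfl | ⟨l, rfl, β, rfl⟩
  · simp
  have h : ∀ {k : Fin m} (α : Form m M (k : ℕ)),
      lowLie m M α.toLow = lieD (wedgeV (k : ℕ) 1 α (idForm m M)) := by
    intro k α
    change lieTot (lowWedgeI m M α.toLow) = _
    rw [lowWedgeI_of, lieTot_of]
  rw [h, h]
  change lieTot (lowWedgeI m M _) = _
  rw [lowBracket_of, lowWedgeI_dropTop, ← fnBracket_wedgeI_wedgeI, lieTot_of]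
  exact (fnBracket_wedgeV_idForm _ β).1

theorem isInternal_lowGrading : DirectSum.IsInternal (lowGrading m M) := by
  -- The component of form degree k of a sum comes only from the summand of grading degree k + 1,
  -- which is the inverse of the summation map.
  have key : ∀ (f : ⨁ n, lowGrading m M n) (k : Fin m),
      (DirectSum.coeAddMonoidHom (lowGrading m M) f) k = (f ((k : ℕ) + 1) : LowForms m M) k := by
    intro f k
    induction f using DirectSum.induction_on with
    | zero => simp
    | add f g hf hg => simp [hf, hg]
    | of n x =>
      rw [DirectSum.coeAddMonoidHom_of]
      by_cases h : n = k + 1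
      · subst h
        rw [DirectSum.of_eq_same]
      · rw [DirectSum.of_eq_of_ne _ _ _ (Ne.symm h), x.2 k (Ne.symm h)]
        rfl
  constructor
  · rw [injective_iff_map_eq_zero]
    intro f hf
    refine DFinsupp.ext fun n => Subtype.ext (DFinsupp.ext fun k => ?_)
    by_cases h : (k : ℕ) + 1 = n
    · subst h
      refine (key f k).symm.trans ?_
      rw [hf]
      rfl
    · exact (f n).2 k h
  · intro u
    induction u using LowForms.induction with
    | h0 => exact ⟨0, map_zero _⟩
    | hadd u v hu hv =>
      obtain ⟨f, rfl⟩ := hu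
      obtain ⟨g, rfl⟩ := hv
      exact ⟨f + g, map_add _ _ _⟩
    | hof k α =>
      exact ⟨DirectSum.of (fun n => lowGrading m M n) ((k : ℕ) + 1)
        ⟨α.toLow, toLow_mem_lowGrading α rfl⟩, DirectSum.coeAddMonoidHom_of _ _ _⟩

/-- Skew symmetry and the Jacobi identity hold for graded commutators of operators. They pull back
along the representation `lowLie`, both sides having the same degree. -/
theorem isGradedLieAlgebra_lowBracket : IsGradedLieAlgebra (lowGrading m M) (lowBracket m M) where
  isInternal := isInternal_lowGrading
  mem _ _ _ hx _ hy := lowBracket_mem hx hy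
  skew i j x hx y hy := by
    have h1 := lowBracket_mem hy hx
    rw [add_comm j i] at h1
    refine lowLie_injOn (lowBracket_mem hx hy)
      (Submodule.neg_mem _ (Submodule.smul_mem _ _ h1)) ?_
    rw [map_neg, map_smul, lowLie_lowBracket hx hy, lowLie_lowBracket hy hx, mul_comm j i]
    rcases Nat.even_or_odd (i * j) with h | h <;> simp only [h.neg_one_pow] <;> module
  jacobi i j k x hx y hy z hz := by
    have h1 := lowBracket_mem (lowBracket_mem hx hy) hz
    have h2 := lowBracket_mem hy (lowBracket_mem hx hz)
    rw [show j + (i + k) = i + (j + k) by ring] at h2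
    rw [add_assoc] at h1
    refine lowLie_injOn (lowBracket_mem hx (lowBracket_mem hy hz))
      (Submodule.add_mem _ h1 (Submodule.smul_mem _ _ h2)) ?_
    rw [map_add, map_smul, lowLie_lowBracket hx (lowBracket_mem hy hz), lowLie_lowBracket hy hz,
      lowLie_lowBracket (lowBracket_mem hx hy) hz, lowLie_lowBracket hx hy,
      lowLie_lowBracket hy (lowBracket_mem hx hz), lowLie_lowBracket hx hz]
    simp only [LinearMap.comp_sub, LinearMap.sub_comp, LinearMap.comp_smul, LinearMap.smul_comp,
      LinearMap.comp_assoc]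
    rcases Nat.even_or_odd i with hi | hi <;> rcases Nat.even_or_odd j with hj | hj <;>
      rcases Nat.even_or_odd k with hk | hk <;>
    simp only [add_mul, mul_add, pow_add, pow_mul, hi.neg_one_pow, hj.neg_one_pow,
      hk.neg_one_pow, one_pow] <;>
    module

end LowForms

end FrolicherNijenhuis

end

/-! ### The main theorem -/

theorem theorem3p1 (m : ℕ) (M : Type*) [TopologicalSpace M] [T2Space M]
    [ChartedSpace (EuclideanSpace ℝ (Fin m)) M] [IsManifold (𝓡 m) ∞ M] :
    IsAbelianIdeal ((exactLow m M).map (lowWedgeI m M)) ∧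
    IsAbelianIdeal ((closedLow m M).map (lowWedgeI m M)) ∧
    IsGradedLieSubalgebra (LinearMap.range (lowWedgeI m M)) ∧
    Function.Injective (lowWedgeI m M) ∧
    ∃ br : LowForms m M →ₗ[ℝ] LowForms m M →ₗ[ℝ] LowForms m M,
      IsGradedLieAlgebra (lowGrading m M) br ∧
      (∀ u v : LowForms m M, lowWedgeI m M (br u v) = fnTot (lowWedgeI m M u) (lowWedgeI m M v)) ∧
      ∀ (k l : Fin m) (α : Form m M (k : ℕ)) (β : Form m M (l : ℕ)),
        br α.toLow β.toLow = dropTop m M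
          ((-1 : ℝ) ^ ((k : ℤ) - 1) •
              wedgeTot m M (dTot m M α.toForms) ((l : ℝ) • β.toForms) -
            (-1 : ℝ) ^ (((k : ℤ) - 1) * ((l : ℤ) - 1)) • (-1 : ℝ) ^ ((l : ℤ) - 1) •
              wedgeTot m M (dTot m M β.toForms) ((k : ℝ) • α.toForms)) ∧
        br α.toLow β.toLow = dropTop m M
          ((-1 : ℝ) ^ ((k : ℤ) - 1) •
              wedgeTot m M (lieD (idForm m M) α.toForms) (insTot (idForm m M) β.toForms) -
            (-1 : ℝ) ^ (((k : ℤ) - 1) * ((l : ℤ) - 1)) • (-1 : ℝ) ^ ((l : ℤ) - 1) •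
              wedgeTot m M (lieD (idForm m M) β.toForms) (insTot (idForm m M) α.toForms)) := by
  have hle : LinearMap.range (dTot m M) ≤ LinearMap.ker (dTot m M) := by
    rintro _ ⟨a, rfl⟩
    exact dTot_dTot a
  have hformula : ∀ (k l : Fin m) (α : Form m M (k : ℕ)) (β : Form m M (l : ℕ)),
      lowBracket m M α.toLow β.toLow = dropTop m M
          ((-1 : ℝ) ^ ((k : ℤ) - 1) •
              wedgeTot m M (dTot m M α.toForms) ((l : ℝ) • β.toForms) -
            (-1 : ℝ) ^ (((k : ℤ) - 1) * ((l : ℤ) - 1)) • (-1 : ℝ) ^ ((l : ℤ) - 1) •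
              wedgeTot m M (dTot m M β.toForms) ((k : ℝ) • α.toForms)) := by
    intro k l α β
    -- The exponents are integers because n - 1 is negative for n = 0; the parity is that of n + 1.
    have hs : ∀ n : ℕ, (-1 : ℝ) ^ ((n : ℤ) - 1) = (-1) ^ (n + 1) := by
      intro n
      rw [zpow_sub₀ (by norm_num), zpow_natCast, pow_succ, zpow_one]
      ring
    rw [lowBracket_of, formBracket_of, zpow_mul, hs, hs, map_smul, map_smul]
    congr 1
    rcases Nat.even_or_odd (k : ℕ) with hk | hk <;>
      rcases Nat.even_or_odd (l : ℕ) with hl | hl <;>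
    simp only [pow_succ, pow_mul, hk.neg_one_pow, hl.neg_one_pow, one_mul, mul_neg_one, neg_neg,
      mul_one, one_zpow, one_pow, hs] <;>
    module
  refine ⟨?_, ?_, isGradedLieSubalgebra_range, lowWedgeI_injective, lowBracket m M,
    isGradedLieAlgebra_lowBracket, lowWedgeI_lowBracket, fun k l α β => ⟨hformula k l α β, ?_⟩⟩
  -- The exact and the closed forms are the two extreme choices between the image and the kernel of
  -- d.
  · rw [exactLow, map_lowWedgeI_comap isGradedFormSubspace_range]
    exact isAbelianIdeal_map_wedgeI isGradedFormSubspace_range hle le_rfl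
  · rw [closedLow, LinearMap.ker_comp, map_lowWedgeI_comap isGradedFormSubspace_ker]
    exact isAbelianIdeal_map_wedgeI isGradedFormSubspace_ker le_rfl hle
  -- Θ(I) is d, and i_I multiplies a form by its degree.
  · rw [lieD_idForm, lieD_idForm, insTot_idForm, insTot_idForm]
    exact hformula k l α β
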